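/- **Setting.** Let $k\ge 2$, $m\ge 1$, and let $u_k$ be the uniform distribution on $[k]=\{1,\dots,k\}$. There are $n$ users; each holds $m$ samples, and all $nm$ samples are i.i.d. from an unknown distribution $p$ on $[k]$. In a (non-interactive) private-coin protocol with $b$ bits of communication per user, user $i$ applies a randomizer $Q_i:[k]^m\to\{0,1\}^b$ to its batch, using randomness independent of that of everybody else, and sends the output to a server, which from the $n$ messages outputs accept or reject. The protocol is *symmetric* if $Q_1=\dots=Q_n$; in an *asymmetric* protocol the $Q_i$ may differ. It is *user-level $\varepsilon$-locally differentially private* ($\varepsilon$-LDP) if $\Pr[Q_i(x)=y]\le e^{\varepsilon}\Pr[Q_i(x')=y]$ for all $i$, all $x,x'\in[k]^m$ and all $y\in\{0,1\}^b$. It is a *uniformity tester with distance parameter $\alpha$* if it accepts with probability at least $2/3$ when $p=u_k$ and rejects with probability at least $2/3$ whenever $d_{\mathrm{TV}}(p,u_k)>\alpha$. **Theorem.** There is an absolute constant $C>0$ such that the following holds for all integers $k\ge2$, $m\ge1$ and reals $\alpha,\varepsilon\in(0,1]$ with $m\le\sqrt{k}/\alpha^2$. 1. (Asymmetric.) For every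 integer $$n\;\ge\; C\,\frac{k^{3/2}\,\log(k/\varepsilon)}{m\,\alpha^2\varepsilon^2}$$ there is a private-coin, user-level $\varepsilon$-LDP uniformity tester over $[k]$ with distance parameter $\alpha$, using $n$ users with $m$ samples each, in which each user sends $1$ bit. 2. (Symmetric.) For every integer $$n\;\ge\; C\,\frac{k^{3/2}\,\max\{1,\log(k/(\varepsilon\alpha m))\}}{m\,\alpha^2\varepsilon^2}$$ there is a symmetric, private-coin, user-level $\varepsilon$-LDP uniformity tester over $[k]$ with distance parameter $\alpha$, using $n$ users with $m$ samples each, in which each user sends at most $C\log k$ bits. -/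

import Mathlib

open scoped ENNReal

noncomputable section

/-- The law of a family of independent random variables with finite ranges, the `i`-th one
having law `μ i`. -/
def indepLaw {ι A : Type*} [Fintype ι] [DecidableEq ι] [Fintype A] (μ : ι → PMF A) :
    PMF (ι → A) :=
  PMF.ofFintype (fun x => ∏ i, μ i (x i)) (by
    rw [← Fintype.prod_sum]
    refine Finset.prod_eq_one fun i _ => ?_
    rw [← tsum_fintype (L := .unconditional A)]
    exact (μ i).tsum_coe)

/-- Total variation distance between two distributions on a finite set. -/
def tvDist {A : Type*} [Fintype A] (p q : PMF A) : ℝ :=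
  1 / 2 * ∑ x, |(p x).toReal - (q x).toReal|

/-- The uniform distribution on a domain of size `k`. -/
abbrev unif (k : ℕ) [NeZero k] : PMF (Fin k) := PMF.uniformOfFintype (Fin k)

/-- A non-interactive private-coin protocol over the domain `Fin k`. There are `n` users, each
holding `m` samples. User `i` applies to its samples its own randomizer, with fresh randomness
that is not shared with anybody, and sends the resulting message of `b` bits to the server, which
decides (`true` means accept). -/
structure Protocol (k m n b : ℕ) where
  randomizer : Fin n → (Fin m → Fin k) → PMF (Fin b → Bool)
  decision : (Fin n → Fin b → Bool) → Bool

namespace Protocol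

variable {k m n b : ℕ}

/-- All users run the same randomizer. -/
def IsSymmetric (P : Protocol k m n b) : Prop :=
  ∀ i j, P.randomizer i = P.randomizer j

/-- User-level `ε`-local differential privacy: the law of the message of a user changes by a factor
at most `exp ε` when the whole batch of `m` samples of that user is replaced by another one. -/
def IsUserLDP (P : Protocol k m n b) (ε : ℝ) : Prop :=
  ∀ (i : Fin n) (x x' : Fin m → Fin k) (y : Fin b → Bool),
    P.randomizer i x y ≤ ENNReal.ofReal (Real.exp ε) * P.randomizer i x' y

/-- The law of the message of user `i`, who holds `m` independent samples from `p`. -/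
def messageLaw (P : Protocol k m n b) (p : PMF (Fin k)) (i : Fin n) : PMF (Fin b → Bool) :=
  (indepLaw fun _ : Fin m => p).bind (P.randomizer i)

/-- The law of the decision of the server when all samples of all users are independent with
law `p`. -/
def decisionLaw (P : Protocol k m n b) (p : PMF (Fin k)) : PMF Bool :=
  (indepLaw (P.messageLaw p)).map P.decision

/-- The protocol accepts the uniform distribution with probability at least `2/3`, and rejects with
probability at least `2/3` every distribution at total variation distance more than `α` from it. -/
def IsUniformityTester [NeZero k] (P : Protocol k m n b) (α : ℝ) : Prop :=
  2 / 3 ≤ P.decisionLaw (unif k) true ∧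
    ∀ p : PMF (Fin k), α < tvDist p (unif k) → 2 / 3 ≤ P.decisionLaw p false

end Protocol

end

/-! Fix a `±1` matrix with `O(k)` rows such that every vector `v` satisfies `⟨v, s_r⟩² ≥ ‖v‖²/64`
for a constant fraction of the rows `s_r` (`exists_signMatrix`). If `p` is `α`-far from uniform,
then `v = p - u_k` has `‖v‖² ≥ 4α²/k` by Cauchy–Schwarz, so a constant fraction of the rows sees a
bias of order at least `α/√k` in the sign of one sample.

A user attached to row `r` adds the signs of its `m` samples, centers the sum at its uniform mean,
divides by `6√m` and truncates to `[-1, 1]`. Truncation keeps the signal: the means under `p` and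
`u_k` still differ by at least a constant times `min(1, √m |⟨v, s_r⟩|)` (`le_sq_expect_clip_sub`).
The statistic is bounded, so releasing a random sign whose mean is `ε/4` times it is private for the
whole batch.

With `g` users per row in each of two groups, the signs of a group form a vector indexed by rows
with mean `μ`, where `μ = 0` for `u_k` and `‖μ‖² ≳ g²ε²mα²` for far `p`. The server thresholds the
inner product of the two vectors. It has mean `‖μ‖²` and variance `O(|R| g² + g ‖μ‖²)`
(`expect_sq_inner_sub_le`), so Chebyshev succeeds once `‖μ‖² ≳ g√|R|`. Since `|R| ≍ k` and `g ≍
n/k`, this is `n ≳ k^{3/2}/(mα²ε²)`; the logarithms in the statement enter only through constant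
lower bounds.

The asymmetric protocol fixes the row of each user. In the symmetric one each user draws a uniform
row and announces it in `O(log k)` bits, which reveals nothing about its data. -/

/-! ### Expectations on finite sets and Chebyshev's inequality. -/

/-- The expectation of a real function under a distribution on a finite set. -/
noncomputable def PMF.expect {A : Type*} [Fintype A] (μ : PMF A) (f : A → ℝ) : ℝ :=
  ∑ a, (μ a).toReal * f a

namespace PMF

variable {A : Type*} [Fintype A]

theorem sum_toReal (μ : PMF A) : ∑ a, (μ a).toReal = 1 := by
  rw [← ENNReal.toReal_sum fun a _ => μ.apply_ne_top a, ← tsum_fintype (L := .unconditional A),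
    μ.tsum_coe, ENNReal.toReal_one]

theorem expect_add (μ : PMF A) (f g : A → ℝ) :
    μ.expect (fun a => f a + g a) = μ.expect f + μ.expect g := by
  simp only [expect, mul_add, Finset.sum_add_distrib]

theorem expect_sub (μ : PMF A) (f g : A → ℝ) :
    μ.expect (fun a => f a - g a) = μ.expect f - μ.expect g := by
  simp only [expect, mul_sub, Finset.sum_sub_distrib]

theorem expect_const_mul (μ : PMF A) (c : ℝ) (f : A → ℝ) :
    μ.expect (fun a => c * f a) = c * μ.expect f := by
  simp only [expect, Finset.mul_sum]
  exact Finset.sum_congr rfl fun a _ => by ring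

theorem expect_const (μ : PMF A) (c : ℝ) : μ.expect (fun _ => c) = c := by
  simp only [expect, ← Finset.sum_mul, sum_toReal, one_mul]

theorem expect_sum {ι : Type*} (μ : PMF A) (s : Finset ι) (f : ι → A → ℝ) :
    μ.expect (fun a => ∑ i ∈ s, f i a) = ∑ i ∈ s, μ.expect (f i) := by
  simp only [expect, Finset.mul_sum]
  exact Finset.sum_comm

theorem expect_mono (μ : PMF A) {f g : A → ℝ} (h : ∀ a, f a ≤ g a) : μ.expect f ≤ μ.expect g :=
  Finset.sum_le_sum fun a _ => mul_le_mul_of_nonneg_left (h a) ENNReal.toReal_nonneg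

theorem abs_expect_le (μ : PMF A) {f : A → ℝ} {c : ℝ} (h : ∀ a, |f a| ≤ c) :
    |μ.expect f| ≤ c := by
  rw [abs_le]
  constructor
  · rw [← μ.expect_const (-c)]
    exact μ.expect_mono fun a => (abs_le.1 (h a)).1
  · rw [← μ.expect_const c]
    exact μ.expect_mono fun a => (abs_le.1 (h a)).2

theorem expect_bind {B : Type*} [Fintype B] (μ : PMF A) (Q : A → PMF B) (f : B → ℝ) :
    (μ.bind Q).expect f = μ.expect fun a => (Q a).expect f := by
  have h (b : B) : (μ.bind Q b).toReal = ∑ a, (μ a).toReal * (Q a b).toReal := by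
    rw [PMF.bind_apply, tsum_fintype, ENNReal.toReal_sum]
    · simp only [ENNReal.toReal_mul]
    · exact fun a _ => ENNReal.mul_ne_top (μ.apply_ne_top a) ((Q a).apply_ne_top b)
  simp only [expect, h, Finset.sum_mul, Finset.mul_sum]
  rw [Finset.sum_comm]
  exact Finset.sum_congr rfl fun a _ => Finset.sum_congr rfl fun b _ => by ring

/-- The variance is at most the second moment. -/
theorem expect_sub_sq_le (μ : PMF A) (f : A → ℝ) :
    μ.expect (fun a => (f a - μ.expect f) ^ 2) ≤ μ.expect fun a => f a ^ 2 := by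
  have h : μ.expect (fun a => (f a - μ.expect f) ^ 2)
      = μ.expect (fun a => f a ^ 2) - μ.expect f ^ 2 := by
    have h1 (a : A) : (f a - μ.expect f) ^ 2
        = f a ^ 2 - (2 * μ.expect f * f a - μ.expect f ^ 2) := by ring
    simp only [h1]
    rw [expect_sub, expect_sub, expect_const_mul, expect_const]
    ring
  rw [h]
  nlinarith [sq_nonneg (μ.expect f)]

/-- Chebyshev's inequality, for the law of a decision. -/
theorem le_map_of_expect_sq_le {B : Type*} (μ : PMF A) (dec : A → B) (b : B) (W : A → ℝ) (M d : ℝ)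
    (hd : 0 < d) (hdec : ∀ a, |W a - M| < d → dec a = b)
    (hvar : 3 * μ.expect (fun a => (W a - M) ^ 2) ≤ d ^ 2) :
    2 / 3 ≤ μ.map dec b := by
  classical
  have h1 : (μ.map dec b).toReal = μ.expect fun a => if dec a = b then 1 else 0 := by
    rw [PMF.map_apply, tsum_fintype, ENNReal.toReal_sum]
    · refine Finset.sum_congr rfl fun a _ => ?_
      by_cases h : dec a = b
      · simp [h]
      · simp [h, Ne.symm h]
    · intro a _
      split_ifs
      exacts [μ.apply_ne_top a, ENNReal.zero_ne_top]
  have h2 : 1 - 1 / d ^ 2 * μ.expect (fun a => (W a - M) ^ 2) ≤ (μ.map dec b).toReal := by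
    rw [h1, ← expect_const_mul]
    nth_rw 1 [← μ.expect_const 1]
    rw [← expect_sub]
    refine μ.expect_mono fun a => ?_
    have hd2 : 0 < d ^ 2 := by positivity
    by_cases h : |W a - M| < d
    · rw [if_pos (hdec a h)]
      have : 0 ≤ 1 / d ^ 2 * (W a - M) ^ 2 := by positivity
      linarith
    · have h3 : d ^ 2 ≤ (W a - M) ^ 2 := by
        rw [← sq_abs (W a - M)]
        exact pow_le_pow_left₀ hd.le (not_lt.1 h) 2
      have h4 : 1 ≤ 1 / d ^ 2 * (W a - M) ^ 2 := by
        rw [one_div, ← div_eq_inv_mul, le_div_iff₀ hd2]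
        linarith
      split_ifs <;> linarith
  have h5 : 1 / d ^ 2 * μ.expect (fun a => (W a - M) ^ 2) ≤ 1 / 3 := by
    rw [one_div, ← div_eq_inv_mul, div_le_iff₀ (by positivity)]
    linarith
  have h6 : (2 / 3 : ℝ) ≤ (μ.map dec b).toReal := by linarith
  have h7 : (2 / 3 : ℝ≥0∞) = ENNReal.ofReal (2 / 3) := by
    rw [ENNReal.ofReal_div_of_pos (by norm_num)]
    norm_num
  rw [h7]
  exact ENNReal.ofReal_le_of_le_toReal h6

end PMF

/-! ### Independent families: resampling, orthogonality, variance bounds. -/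

section indepLaw

variable {ι A : Type*} [Fintype ι] [DecidableEq ι] [Fintype A]

theorem indepLaw_toReal (μ : ι → PMF A) (x : ι → A) :
    (indepLaw μ x).toReal = ∏ i, (μ i (x i)).toReal := by
  simp [indepLaw, ENNReal.toReal_prod]

/-- Fubini: the `i`-th variable may be integrated first. -/
theorem expect_indepLaw_update (μ : ι → PMF A) (i : ι) (ν : PMF A) (F : (ι → A) → ℝ) :
    (indepLaw (Function.update μ i ν)).expect F
      = (indepLaw μ).expect fun x => ν.expect fun a => F (Function.update x i a) := by
  simp only [PMF.expect, indepLaw_toReal, Finset.mul_sum]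
  rw [← Fintype.sum_prod_type']
  -- Exchanging the `i`-th coordinate with the fresh value is an involution.
  let e : (ι → A) × A ≃ (ι → A) × A :=
    { toFun := fun q => (Function.update q.1 i q.2, q.1 i)
      invFun := fun q => (Function.update q.1 i q.2, q.1 i)
      left_inv := fun q => by simp
      right_inv := fun q => by simp }
  rw [← e.sum_comp, Fintype.sum_prod_type]
  refine Finset.sum_congr rfl fun x _ => ?_
  have h (a : A) : (∏ j, (μ j (Function.update x i a j)).toReal)
      = (μ i a).toReal * ∏ j ∈ Finset.univ.erase i, (μ j (x j)).toReal := by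
    rw [← Finset.mul_prod_erase _ _ (Finset.mem_univ i), Function.update_self]
    congr 1
    refine Finset.prod_congr rfl fun j hj => ?_
    rw [Function.update_of_ne (Finset.ne_of_mem_erase hj)]
  simp only [e, Equiv.coe_fn_mk, Function.update_idem, Function.update_eq_self, h]
  rw [← Finset.mul_prod_erase _ _ (Finset.mem_univ i), Function.update_self]
  have h2 : ∏ j ∈ Finset.univ.erase i, (Function.update μ i ν j (x j)).toReal
      = ∏ j ∈ Finset.univ.erase i, (μ j (x j)).toReal := by
    refine Finset.prod_congr rfl fun j hj => ?_
    rw [Function.update_of_ne (Finset.ne_of_mem_erase hj)]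
  rw [h2]
  have h3 := (μ i).sum_toReal
  calc _ = (∑ a, (μ i a).toReal) * ((ν (x i)).toReal *
        (∏ j ∈ Finset.univ.erase i, (μ j (x j)).toReal) * F x) := by rw [h3, one_mul]
    _ = _ := by
      rw [Finset.sum_mul]
      exact Finset.sum_congr rfl fun a _ => by ring

theorem expect_indepLaw_resample (μ : ι → PMF A) (i : ι) (F : (ι → A) → ℝ) :
    (indepLaw μ).expect F
      = (indepLaw μ).expect fun x => (μ i).expect fun a => F (Function.update x i a) := by
  rw [← expect_indepLaw_update, Function.update_eq_self]

theorem expect_indepLaw_apply (μ : ι → PMF A) (i : ι) (f : A → ℝ) :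
    (indepLaw μ).expect (fun x => f (x i)) = (μ i).expect f := by
  rw [expect_indepLaw_resample μ i]
  simp [PMF.expect_const]

/-- Orthogonality of functions that are centered in one variable each. -/
theorem expect_sq_sum_of_centered (μ : ι → PMF A) (J : Finset ι) (G : ι → (ι → A) → ℝ)
    (hcent : ∀ j ∈ J, ∀ x, (μ j).expect (fun a => G j (Function.update x j a)) = 0)
    (hindep : ∀ j ∈ J, ∀ j' ∈ J, j ≠ j' → ∀ x a, G j' (Function.update x j a) = G j' x) :
    (indepLaw μ).expect (fun x => (∑ j ∈ J, G j x) ^ 2)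
      = ∑ j ∈ J, (indepLaw μ).expect fun x => G j x ^ 2 := by
  simp only [sq, Finset.sum_mul_sum, PMF.expect_sum]
  refine Finset.sum_congr rfl fun j hj => ?_
  rw [Finset.sum_eq_single_of_mem j hj]
  intro j' hj' hne
  rw [expect_indepLaw_resample μ j]
  have h (x : ι → A) : (μ j).expect (fun a =>
      G j (Function.update x j a) * G j' (Function.update x j a)) = 0 := by
    have h1 (a : A) : G j (Function.update x j a) * G j' (Function.update x j a)
        = G j' x * G j (Function.update x j a) := by
      rw [hindep j hj j' hj' hne.symm, mul_comm]
    simp only [h1]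
    rw [PMF.expect_const_mul, hcent j hj, mul_zero]
  simp only [h, PMF.expect_const]

/-- The variance of a sum of independent variables is at most the sum of the second moments. -/
theorem expect_sq_sum_sub_le (μ : ι → PMF A) (J : Finset ι) (f : ι → A → ℝ) :
    (indepLaw μ).expect (fun x => (∑ j ∈ J, f j (x j) - ∑ j ∈ J, (μ j).expect (f j)) ^ 2)
      ≤ ∑ j ∈ J, (μ j).expect fun a => f j a ^ 2 := by
  simp only [← Finset.sum_sub_distrib]
  rw [expect_sq_sum_of_centered μ J fun j x => f j (x j) - (μ j).expect (f j)]
  · refine Finset.sum_le_sum fun j _ => ?_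
    rw [expect_indepLaw_apply μ j fun a => (f j a - (μ j).expect (f j)) ^ 2]
    exact (μ j).expect_sub_sq_le (f j)
  · intro j _ x
    simp [PMF.expect_sub, PMF.expect_const]
  · intro j _ j' _ hne x a
    rw [Function.update_of_ne hne.symm]

/-- The second moment of the inner product of two independent sums of independent vectors. -/
theorem expect_sq_inner_sub_le {R : Type*} [Fintype R] [DecidableEq R] (ν : ι → PMF A)
    (I J : Finset ι) (hIJ : Disjoint I J) (φ : ι → A → R → ℝ) (σ : ℝ) (hσ : 0 ≤ σ) (μ : R → ℝ)
    (hI : ∀ v : R → ℝ, ∑ i ∈ I, (ν i).expect (fun a => (∑ r, v r * φ i a r) ^ 2)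
      ≤ σ * ∑ r, v r ^ 2)
    (hJ : ∀ v : R → ℝ, ∑ i ∈ J, (ν i).expect (fun a => (∑ r, v r * φ i a r) ^ 2)
      ≤ σ * ∑ r, v r ^ 2)
    (hμI : ∀ r, ∑ i ∈ I, (ν i).expect (fun a => φ i a r) = μ r)
    (hμJ : ∀ r, ∑ i ∈ J, (ν i).expect (fun a => φ i a r) = μ r) :
    (indepLaw ν).expect (fun y =>
        (∑ r, (∑ i ∈ I, φ i (y i) r) * (∑ j ∈ J, φ j (y j) r) - ∑ r, μ r ^ 2) ^ 2)
      ≤ 4 * Fintype.card R * σ ^ 2 + 6 * σ * ∑ r, μ r ^ 2 := by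
  -- With `Y` the sum over `J`, the error is `⟨X, Y - μ⟩ + ⟨X - μ, μ⟩`. Since `I` and `J` are
  -- disjoint, the summands of the first term are centered even with `X` frozen, so its second
  -- moment is at most `σ E‖X‖²`.
  set X : (ι → A) → R → ℝ := fun y r => ∑ i ∈ I, φ i (y i) r with hX
  have hinner (K : Finset ι) (hK : ∀ r, ∑ i ∈ K, (ν i).expect (fun a => φ i a r) = μ r)
      (v : R → ℝ) : ∑ i ∈ K, (ν i).expect (fun a => ∑ r, v r * φ i a r) = ∑ r, v r * μ r := by
    simp only [PMF.expect_sum, PMF.expect_const_mul]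
    rw [Finset.sum_comm]
    simp only [← Finset.mul_sum, hK]
  -- the fluctuation of the first factor
  have h1 : (indepLaw ν).expect (fun y => (∑ r, μ r * X y r - ∑ r, μ r ^ 2) ^ 2)
      ≤ σ * ∑ r, μ r ^ 2 := by
    have h := expect_sq_sum_sub_le ν I fun i a => ∑ r, μ r * φ i a r
    rw [hinner I hμI μ] at h
    refine le_trans (le_of_eq ?_) (h.trans (hI μ))
    congr 1
    funext y
    congr 2
    · rw [Finset.sum_comm]
      simp only [hX, Finset.mul_sum]
    · exact Finset.sum_congr rfl fun r _ => sq _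
  -- the size of the first factor
  have h2 : (indepLaw ν).expect (fun y => ∑ r, X y r ^ 2)
      ≤ 2 * (Fintype.card R * σ) + 2 * ∑ r, μ r ^ 2 := by
    rw [PMF.expect_sum]
    have h (r : R) : (indepLaw ν).expect (fun y => X y r ^ 2) ≤ 2 * σ + 2 * μ r ^ 2 := by
      have h3 := expect_sq_sum_sub_le ν I fun i a => φ i a r
      rw [hμI r] at h3
      have h4 := hI (Pi.single r 1)
      simp only [Pi.single_apply, ite_mul, one_mul, zero_mul, Finset.sum_ite_eq',
        Finset.mem_univ, if_true, ite_pow, one_pow, ne_eq, OfNat.ofNat_ne_zero,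
        not_false_eq_true, zero_pow, mul_one] at h4
      calc (indepLaw ν).expect (fun y => X y r ^ 2)
          ≤ (indepLaw ν).expect (fun y => 2 * (X y r - μ r) ^ 2 + 2 * μ r ^ 2) :=
            PMF.expect_mono _ fun y => by nlinarith [sq_nonneg (X y r - 2 * μ r)]
        _ = 2 * (indepLaw ν).expect (fun y => (X y r - μ r) ^ 2) + 2 * μ r ^ 2 := by
            rw [PMF.expect_add, PMF.expect_const_mul, PMF.expect_const]
        _ ≤ _ := by linarith
    refine (Finset.sum_le_sum fun r _ => h r).trans (le_of_eq ?_)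
    rw [Finset.sum_add_distrib, Finset.sum_const, Finset.card_univ, nsmul_eq_mul, Finset.mul_sum]
    ring
  -- the fluctuation of the second factor
  have h3 : (indepLaw ν).expect (fun y =>
      (∑ r, X y r * (∑ j ∈ J, φ j (y j) r) - ∑ r, X y r * μ r) ^ 2)
      ≤ σ * (indepLaw ν).expect (fun y => ∑ r, X y r ^ 2) := by
    have hXu (y : ι → A) (j : ι) (hj : j ∈ J) (a : A) : X (Function.update y j a) = X y := by
      funext r
      refine Finset.sum_congr rfl fun i hi => ?_
      rw [Function.update_of_ne]
      rintro rfl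
      exact Finset.disjoint_left.1 hIJ hi hj
    have he (y : ι → A) : ∑ r, X y r * (∑ j ∈ J, φ j (y j) r) - ∑ r, X y r * μ r
        = ∑ j ∈ J, (∑ r, X y r * φ j (y j) r
            - (ν j).expect (fun a => ∑ r, X y r * φ j a r)) := by
      rw [Finset.sum_sub_distrib, hinner J hμJ, Finset.sum_comm]
      simp only [Finset.mul_sum]
    simp only [he]
    rw [expect_sq_sum_of_centered ν J fun j y => ∑ r, X y r * φ j (y j) r
            - (ν j).expect (fun a => ∑ r, X y r * φ j a r)]
    · rw [← PMF.expect_const_mul]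
      refine le_trans ?_ (PMF.expect_mono _ fun y => hJ (X y))
      rw [PMF.expect_sum]
      refine Finset.sum_le_sum fun j hj => ?_
      rw [expect_indepLaw_resample ν j]
      refine PMF.expect_mono _ fun y => ?_
      simp only [hXu y j hj, Function.update_self]
      exact (ν j).expect_sub_sq_le fun a => ∑ r, X y r * φ j a r
    · intro j hj y
      simp only [hXu y j hj, Function.update_self, PMF.expect_sub, PMF.expect_const, sub_self]
    · intro j hj j' _ hne y a
      simp only [hXu y j hj, Function.update_of_ne hne.symm]
  calc _ ≤ (indepLaw ν).expect (fun y =>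
          2 * (∑ r, X y r * (∑ j ∈ J, φ j (y j) r) - ∑ r, X y r * μ r) ^ 2
            + 2 * (∑ r, μ r * X y r - ∑ r, μ r ^ 2) ^ 2) := by
        refine PMF.expect_mono _ fun y => ?_
        have hc : ∑ r, μ r * X y r = ∑ r, X y r * μ r :=
          Finset.sum_congr rfl fun r _ => mul_comm _ _
        rw [hc]
        generalize ∑ r, X y r * μ r = b
        nlinarith [sq_nonneg (∑ r, X y r * (∑ j ∈ J, φ j (y j) r) - b - (b - ∑ r, μ r ^ 2))]
    _ ≤ _ := by
        rw [PMF.expect_add, PMF.expect_const_mul, PMF.expect_const_mul]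
        have h4 := h3.trans (mul_le_mul_of_nonneg_left h2 hσ)
        nlinarith

end indepLaw

/-! ### Truncated sums of signs, compared under two laws by a hybrid argument. -/

/-- Truncation of a real number to `[-1, 1]`. -/
noncomputable def clip (t : ℝ) : ℝ := max (-1) (min 1 t)

theorem clip_mono : Monotone clip := fun _ _ h => max_le_max le_rfl (min_le_min le_rfl h)

theorem abs_clip_le (t : ℝ) : |clip t| ≤ 1 :=
  abs_le.2 ⟨le_max_left _ _, max_le (by norm_num) (min_le_left _ _)⟩

theorem clip_of_abs_le {t : ℝ} (h : |t| ≤ 1) : clip t = t := by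
  rw [clip, min_eq_right (abs_le.1 h).2, max_eq_right (abs_le.1 h).1]

theorem clip_neg (t : ℝ) : clip (-t) = -clip t := by
  simp only [clip]
  rw [max_def, min_def, max_def, min_def]
  split_ifs <;> linarith

section hybrid

variable {A : Type*} {m : ℕ}

/-- The first `j` samples have law `p` and the others have law `q`. -/
def hybrid (p q : PMF A) (m j : ℕ) (i : Fin m) : PMF A := if i.val < j then p else q

theorem hybrid_succ (p q : PMF A) (j : Fin m) :
    hybrid p q m (j + 1) = Function.update (hybrid p q m j) j p := by
  funext i
  by_cases h : i = j
  · subst h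
    simp [hybrid]
  · rw [Function.update_of_ne h]
    have : i.val ≠ j.val := fun h' => h (Fin.ext h')
    simp only [hybrid, show i.val < j.val + 1 ↔ i.val < j.val by omega]

theorem hybrid_self (p q : PMF A) (j : Fin m) : hybrid p q m j j = q := by
  simp [hybrid]

variable [Fintype A]

/-- Replacing one law `q` by `p` changes the expectation of a function of a sum of signs
proportionally to the discrete derivative of the function. -/
theorem expect_hybrid_succ_sub (p q : PMF A) (s : A → ℝ) (hs : ∀ a, s a = 1 ∨ s a = -1)
    (G : ℝ → ℝ) (j : Fin m) :
    (indepLaw (hybrid p q m (j + 1))).expect (fun x => G (∑ i, s (x i)))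
        - (indepLaw (hybrid p q m j)).expect (fun x => G (∑ i, s (x i)))
      = (p.expect s - q.expect s) * (indepLaw (hybrid p q m j)).expect fun x =>
          (G (∑ i ∈ Finset.univ.erase j, s (x i) + 1)
            - G (∑ i ∈ Finset.univ.erase j, s (x i) - 1)) / 2 := by
  have hr := expect_indepLaw_resample (hybrid p q m j) j fun x => G (∑ i, s (x i))
  rw [hybrid_succ, expect_indepLaw_update, hr, ← PMF.expect_sub, ← PMF.expect_const_mul]
  congr 1
  funext x
  rw [hybrid_self]
  set S := ∑ i ∈ Finset.univ.erase j, s (x i) with hS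
  have h1 (a : A) : G (∑ i, s (Function.update x j a i))
      = (G (S + 1) + G (S - 1)) / 2 + (G (S + 1) - G (S - 1)) / 2 * s a := by
    have h2 : ∑ i, s (Function.update x j a i) = S + s a := by
      rw [← Finset.sum_erase_add _ _ (Finset.mem_univ j), Function.update_self, hS]
      congr 1
      refine Finset.sum_congr rfl fun i hi => ?_
      rw [Function.update_of_ne (Finset.ne_of_mem_erase hi)]
    rw [h2]
    rcases hs a with h | h <;> rw [h] <;> ring_nf
  simp only [h1, PMF.expect_add, PMF.expect_const, PMF.expect_const_mul]
  ring

theorem abs_expect_sign_le (p : PMF A) (s : A → ℝ) (hs : ∀ a, s a = 1 ∨ s a = -1) :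
    |p.expect s| ≤ 1 :=
  p.abs_expect_le fun a => by rcases hs a with h | h <;> simp [h]

theorem sum_expect_hybrid (p q : PMF A) (s : A → ℝ) (j : Fin m) :
    ∑ i ∈ Finset.univ.erase j, (hybrid p q m j i).expect s
      = (m - 1) * q.expect s + j * (p.expect s - q.expect s) := by
  have h1 (i : Fin m) : (hybrid p q m j i).expect s
      = q.expect s + if i < j then p.expect s - q.expect s else 0 := by
    simp only [hybrid, Fin.lt_def]
    split_ifs <;> ring
  have h2 := Finset.sum_erase_add Finset.univ (fun i => (hybrid p q m j i).expect s)
    (Finset.mem_univ j)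
  have h3 : ∑ i, (hybrid p q m j i).expect s
      = m * q.expect s + j * (p.expect s - q.expect s) := by
    simp only [h1, Finset.sum_add_distrib, ← Finset.sum_filter, Finset.sum_const, nsmul_eq_mul,
      Finset.card_univ, Fintype.card_fin, Finset.filter_gt_eq_Iio, Fin.card_Iio]
  rw [h3, hybrid_self] at h2
  linarith

/-- The derivative of the truncated statistic in one sample is large on average. -/
theorem expect_hybrid_deriv_ge (p q : PMF A) (s : A → ℝ) (hs : ∀ a, s a = 1 ∨ s a = -1)
    (j : Fin m) (hj : (j : ℝ) * |p.expect s - q.expect s| ≤ 2 * √m) :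
    1 / (8 * √m) ≤ (indepLaw (hybrid p q m j)).expect fun x =>
      (clip ((∑ i ∈ Finset.univ.erase j, s (x i) + 1 - m * q.expect s) / (6 * √m))
        - clip ((∑ i ∈ Finset.univ.erase j, s (x i) - 1 - m * q.expect s) / (6 * √m))) / 2 := by
  have hm : 1 ≤ m := by have := j.2; omega
  have hm1 : (1 : ℝ) ≤ m := by exact_mod_cast hm
  have hsm : 1 ≤ √(m : ℝ) := Real.one_le_sqrt.2 hm1
  have hsq : √(m : ℝ) ^ 2 = m := Real.sq_sqrt (by positivity)
  set μ := q.expect s with hμ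
  set δ := p.expect s - μ with hδ
  have hμ1 : |μ| ≤ 1 := abs_expect_sign_le q s hs
  set c := (m - 1) * μ + j * δ with hc
  have hvar := expect_sq_sum_sub_le (hybrid p q m j) (Finset.univ.erase j) fun _ => s
  rw [sum_expect_hybrid, ← hc] at hvar
  have hs2 (a : A) : s a ^ 2 = 1 := by rcases hs a with h | h <;> simp [h]
  simp only [hs2, PMF.expect_const, Finset.sum_const, Finset.card_erase_of_mem (Finset.mem_univ j),
    Finset.card_univ, Fintype.card_fin, nsmul_eq_mul, mul_one, Nat.cast_sub hm, Nat.cast_one]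
    at hvar
  -- A Markov-type minorant. If `|S - c| ≤ 2√m`, both arguments of `clip` are at most `(4√m +
  -- 2)/(6√m) ≤ 1` in absolute value, so nothing is truncated and the increment is exactly
  -- `1/(6√m)`. Otherwise the left side is at most `0`, and monotonicity of `clip` suffices. As the
  -- variance is at most `m`, a quarter of the increment is lost on average.
  have hpt (x : Fin m → A) :
      1 / (6 * √m) - 1 / (24 * √m * m) * (∑ i ∈ Finset.univ.erase j, s (x i) - c) ^ 2
      ≤ (clip ((∑ i ∈ Finset.univ.erase j, s (x i) + 1 - m * μ) / (6 * √m))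
        - clip ((∑ i ∈ Finset.univ.erase j, s (x i) - 1 - m * μ) / (6 * √m))) / 2 := by
    generalize ∑ i ∈ Finset.univ.erase j, s (x i) = S
    by_cases h : |S - c| ≤ 2 * √m
    · have h1 : |c - m * μ| ≤ 2 * √m + 1 := by
        have : c - m * μ = j * δ - μ := by rw [hc]; ring
        rw [this]
        refine (abs_sub _ _).trans ?_
        rw [abs_mul, Nat.abs_cast]
        linarith
      have h2 : |S - m * μ| ≤ 4 * √m + 1 := by
        have : S - m * μ = (S - c) + (c - m * μ) := by ring
        rw [this]
        exact (abs_add_le _ _).trans (by linarith)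
      have h3 := abs_le.1 h2
      have h4 (e : ℝ) (he : |e| ≤ 1) : |(S + e - m * μ) / (6 * √m)| ≤ 1 := by
        have h5 := abs_le.1 he
        rw [abs_div, abs_of_pos (show 0 < 6 * √(m : ℝ) by positivity),
          div_le_one (by positivity), abs_le]
        constructor <;> linarith
      have h6 : S - 1 - m * μ = S + (-1) - m * μ := by ring
      rw [h6, clip_of_abs_le (h4 1 (by simp)), clip_of_abs_le (h4 (-1) (by simp))]
      have h7 : ((S + 1 - m * μ) / (6 * √m) - (S + -1 - m * μ) / (6 * √m)) / 2
          = 1 / (6 * √m) := by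
        field_simp
        ring
      rw [h7]
      have : 0 ≤ 1 / (24 * √m * m) * (S - c) ^ 2 := by positivity
      linarith
    · have h1 : 4 * m ≤ (S - c) ^ 2 := by
        rw [← sq_abs]
        nlinarith [not_le.1 h]
      have h2 : 1 / (6 * √m) ≤ 1 / (24 * √m * m) * (S - c) ^ 2 := by
        calc 1 / (6 * √(m : ℝ)) = 1 / (24 * √m * m) * (4 * m) := by
              field_simp
              norm_num
          _ ≤ _ := by gcongr
      have h3 : clip ((S - 1 - m * μ) / (6 * √m)) ≤ clip ((S + 1 - m * μ) / (6 * √m)) := by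
        apply clip_mono
        gcongr
        linarith
      linarith
  refine le_trans ?_ (PMF.expect_mono _ hpt)
  rw [PMF.expect_sub, PMF.expect_const, PMF.expect_const_mul]
  have h8 : 1 / (24 * √m * m) * (indepLaw (hybrid p q m j)).expect
      (fun x => (∑ i ∈ Finset.univ.erase j, s (x i) - c) ^ 2) ≤ 1 / (24 * √m * m) * m := by
    gcongr
    linarith
  have h9 : 1 / (6 * √(m : ℝ)) - 1 / (24 * √m * m) * m = 1 / (8 * √m) := by
    field_simp
    norm_num
  linarith

/-- Replace `q` by `p` one sample at a time and telescope. Every step is nonnegative by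
monotonicity, and a step gains at least `δ/(8√m)` as long as the mean has drifted by at most `2√m`,
that is, before truncation saturates. -/
theorem le_expect_clip_sub_of_nonneg (p q : PMF A) (s : A → ℝ) (hs : ∀ a, s a = 1 ∨ s a = -1)
    (hm : 1 ≤ m) (hδ : 0 ≤ p.expect s - q.expect s) :
    1 / 8 * min 1 (√m * (p.expect s - q.expect s))
      ≤ (indepLaw fun _ : Fin m => p).expect
          (fun x => clip ((∑ i, s (x i) - m * q.expect s) / (6 * √m)))
        - (indepLaw fun _ : Fin m => q).expect
          (fun x => clip ((∑ i, s (x i) - m * q.expect s) / (6 * √m))) := by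
  have hm1 : (1 : ℝ) ≤ m := by exact_mod_cast hm
  have hsm : 1 ≤ √(m : ℝ) := Real.one_le_sqrt.2 hm1
  have hsq : √(m : ℝ) ^ 2 = m := Real.sq_sqrt (by positivity)
  set G : ℝ → ℝ := fun t => clip ((t - m * q.expect s) / (6 * √m)) with hG
  have hGmono : Monotone G := fun t t' h => clip_mono (by gcongr)
  set E : ℕ → ℝ := fun j => (indepLaw (hybrid p q m j)).expect fun x => G (∑ i, s (x i)) with hE
  set δ := p.expect s - q.expect s with hδd
  have hE0 : E 0 = (indepLaw fun _ : Fin m => q).expect fun x => G (∑ i, s (x i)) := by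
    have h : hybrid p q m 0 = fun _ => q := by funext i; simp [hybrid]
    rw [hE, ← h]
  have hEm : E m = (indepLaw fun _ : Fin m => p).expect fun x => G (∑ i, s (x i)) := by
    have h : hybrid p q m m = fun _ => p := by funext i; simp [hybrid]
    rw [hE, ← h]
  change _ ≤ (indepLaw fun _ : Fin m => p).expect (fun x => G (∑ i, s (x i)))
    - (indepLaw fun _ : Fin m => q).expect (fun x => G (∑ i, s (x i)))
  rw [← hE0, ← hEm]
  have hstep (j : ℕ) (hj : j < m) : E (j + 1) - E j
      = δ * (indepLaw (hybrid p q m j)).expect fun x =>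
          (G (∑ i ∈ Finset.univ.erase ⟨j, hj⟩, s (x i) + 1)
            - G (∑ i ∈ Finset.univ.erase ⟨j, hj⟩, s (x i) - 1)) / 2 :=
    expect_hybrid_succ_sub p q s hs G ⟨j, hj⟩
  have hnonneg (j : ℕ) (hj : j < m) : 0 ≤ E (j + 1) - E j := by
    rw [hstep j hj]
    refine mul_nonneg hδ ?_
    rw [← PMF.expect_const (indepLaw (hybrid p q m j)) 0]
    refine PMF.expect_mono _ fun x => ?_
    have := hGmono (show ∑ i ∈ Finset.univ.erase ⟨j, hj⟩, s (x i) - 1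
      ≤ ∑ i ∈ Finset.univ.erase ⟨j, hj⟩, s (x i) + 1 by linarith)
    linarith
  have hlarge (j : ℕ) (hj : j < m) (hjδ : j * δ ≤ 2 * √m) : δ * (1 / (8 * √m)) ≤ E (j + 1) - E j := by
    rw [hstep j hj]
    refine mul_le_mul_of_nonneg_left ?_ hδ
    refine expect_hybrid_deriv_ge p q s hs ⟨j, hj⟩ ?_
    rw [abs_of_nonneg hδ]
    exact hjδ
  rcases hδ.eq_or_lt with h0 | hpos
  · rw [← h0, mul_zero, min_eq_right zero_le_one, mul_zero, ← Finset.sum_range_sub]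
    exact Finset.sum_nonneg fun j hj => hnonneg j (Finset.mem_range.1 hj)
  have hδ2 : δ ≤ 2 := by
    have h1 := abs_le.1 (abs_expect_sign_le p s hs)
    have h2 := abs_le.1 (abs_expect_sign_le q s hs)
    linarith
  -- The number of steps counted before saturation. As `δ ≤ 2`, the floor is at least `1`, so
  -- rounding loses at most a factor `2`.
  set N := min m ⌊2 * √(m : ℝ) / δ⌋₊ with hN
  have hN1 : ∑ j ∈ Finset.range N, (E (j + 1) - E j) ≤ E m - E 0 := by
    rw [← Finset.sum_range_sub]
    refine Finset.sum_le_sum_of_subset_of_nonneg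
      (Finset.range_subset_range.2 (min_le_left _ _)) fun j hj _ => hnonneg j (Finset.mem_range.1 hj)
  have hN2 : N * (δ * (1 / (8 * √m))) ≤ ∑ j ∈ Finset.range N, (E (j + 1) - E j) := by
    rw [← nsmul_eq_mul, ← Finset.card_range N, ← Finset.sum_const, Finset.card_range]
    refine Finset.sum_le_sum fun j hj => ?_
    have hj := Finset.mem_range.1 hj
    refine hlarge j (hj.trans_le (min_le_left _ _)) ?_
    have h1 : (j : ℝ) ≤ ⌊2 * √(m : ℝ) / δ⌋₊ := by exact_mod_cast (hj.le.trans (min_le_right _ _))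
    exact (le_div_iff₀ hpos).1 (h1.trans (Nat.floor_le (by positivity)))
  have hN3 : min √m (m * δ) ≤ N * δ := by
    rcases min_choice m ⌊2 * √(m : ℝ) / δ⌋₊ with h | h
    · rw [hN, h]
      exact min_le_right _ _
    · rw [hN, h]
      refine (min_le_left _ _).trans ?_
      have hx : 1 ≤ 2 * √(m : ℝ) / δ := by rw [le_div_iff₀ hpos]; linarith
      have h1 : (1 : ℝ) ≤ ⌊2 * √(m : ℝ) / δ⌋₊ := by
        exact_mod_cast Nat.one_le_floor_iff _ |>.2 hx
      have h2 := Nat.lt_floor_add_one (2 * √(m : ℝ) / δ)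
      have h3 : 2 * √(m : ℝ) / δ ≤ 2 * ⌊2 * √(m : ℝ) / δ⌋₊ := by linarith
      rw [div_le_iff₀ hpos] at h3
      linarith
  refine le_trans ?_ (hN2.trans hN1)
  have h4 : (1 : ℝ) / 8 * min 1 (√m * δ) = min √m (m * δ) / (8 * √m) := by
    have : min √(m : ℝ) (m * δ) = √m * min 1 (√m * δ) := by
      rw [mul_min_of_nonneg _ _ (by positivity), mul_one, ← mul_assoc, ← sq, hsq]
    rw [this]
    field_simp
  rw [h4]
  calc min √m (m * δ) / (8 * √m) ≤ N * δ / (8 * √m) := by gcongr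
    _ = _ := by ring

/-- The truncated sum of the signs of `m` samples distinguishes `p` from `q` almost as well as an
untruncated one. -/
theorem le_sq_expect_clip_sub (p q : PMF A) (s : A → ℝ) (hs : ∀ a, s a = 1 ∨ s a = -1)
    (hm : 1 ≤ m) :
    1 / 64 * min 1 (m * (p.expect s - q.expect s) ^ 2)
      ≤ ((indepLaw fun _ : Fin m => p).expect
          (fun x => clip ((∑ i, s (x i) - m * q.expect s) / (6 * √m)))
        - (indepLaw fun _ : Fin m => q).expect
          (fun x => clip ((∑ i, s (x i) - m * q.expect s) / (6 * √m)))) ^ 2 := by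
  have key (δ D : ℝ) (hδ : 0 ≤ δ) (h : 1 / 8 * min 1 (√m * δ) ≤ D) :
      1 / 64 * min 1 (m * δ ^ 2) ≤ D ^ 2 := by
    have h0 : 0 ≤ min 1 (√m * δ) := le_min zero_le_one (by positivity)
    have h1 : min 1 (m * δ ^ 2) = min 1 (√m * δ) ^ 2 := by
      have h2 : m * δ ^ 2 = (√m * δ) ^ 2 := by rw [mul_pow, Real.sq_sqrt (by positivity)]
      rw [h2]
      rcases le_total 1 (√m * δ) with h3 | h3
      · rw [min_eq_left h3, min_eq_left (one_le_pow₀ h3), one_pow]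
      · rw [min_eq_right h3, min_eq_right (pow_le_one₀ (by positivity) h3)]
    rw [h1]
    nlinarith
  rcases le_total 0 (p.expect s - q.expect s) with h | h
  · exact key _ _ h (le_expect_clip_sub_of_nonneg p q s hs hm h)
  · have hneg (r : PMF A) : r.expect (fun a => -s a) = -r.expect s := by
      simpa using r.expect_const_mul (-1) s
    have h1 := le_expect_clip_sub_of_nonneg (m := m) p q (fun a => -s a)
      (fun a => by rcases hs a with h | h <;> simp [h]) hm (by rw [hneg, hneg]; linarith)
    have hclip (x : Fin m → A) : clip ((∑ i, -s (x i) - m * -q.expect s) / (6 * √m))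
        = -1 * clip ((∑ i, s (x i) - m * q.expect s) / (6 * √m)) := by
      rw [neg_one_mul, ← clip_neg, Finset.sum_neg_distrib]
      congr 1
      ring
    simp only [hneg, hclip] at h1
    simp only [PMF.expect_const_mul] at h1
    have h2 := key _ _ (by linarith) h1
    rw [show -p.expect s - -q.expect s = -(p.expect s - q.expect s) by ring, neg_sq] at h2
    refine h2.trans (le_of_eq ?_)
    ring

end hybrid

/-! ### Moments and anticoncentration of sums of random signs. -/

theorem expect_indepLaw_prod {ι A : Type*} [Fintype ι] [DecidableEq ι] [Fintype A]
    (μ : ι → PMF A) (f : ι → A → ℝ) :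
    (indepLaw μ).expect (fun x => ∏ i, f i (x i)) = ∏ i, (μ i).expect (f i) := by
  simp only [PMF.expect, indepLaw_toReal, Fintype.prod_sum, Finset.prod_mul_distrib]

theorem PMF.exists_lt_of_expect_lt {A : Type*} [Fintype A] (μ : PMF A) {f : A → ℝ} {c : ℝ}
    (h : μ.expect f < c) : ∃ a, f a < c := by
  by_contra! hc
  have := μ.expect_mono hc
  rw [μ.expect_const] at this
  linarith

/-- The sign `1` or `-1`. -/
def sgn (b : Bool) : ℝ := if b then 1 else -1

theorem sgn_eq (b : Bool) : sgn b = 1 ∨ sgn b = -1 := by cases b <;> simp [sgn]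

theorem sgn_sq (b : Bool) : sgn b ^ 2 = 1 := by cases b <;> simp [sgn]

theorem sgn_decide_mul (t : ℝ) : sgn (decide (0 ≤ t)) * t = |t| := by
  by_cases h : 0 ≤ t
  · simp [sgn, h, abs_of_nonneg h]
  · simp [sgn, h, abs_of_neg (not_le.1 h)]

theorem expect_uniform_bool (f : Bool → ℝ) :
    (PMF.uniformOfFintype Bool).expect f = (f true + f false) / 2 := by
  simp [PMF.expect]
  ring

section Rademacher

variable {ι : Type*} [Fintype ι] [DecidableEq ι]

/-- The law of independent uniform signs. -/
noncomputable def rademacher (ι : Type*) [Fintype ι] [DecidableEq ι] : PMF (ι → Bool) :=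
  indepLaw fun _ => PMF.uniformOfFintype Bool

theorem rademacher_sum_insert (z : ι → ℝ) {s : Finset ι} {i : ι} (hi : i ∉ s) (f : ℝ → ℝ) :
    (rademacher ι).expect (fun x => f (∑ j ∈ insert i s, z j * sgn (x j)))
      = (rademacher ι).expect fun x => (f (∑ j ∈ s, z j * sgn (x j) + z i)
        + f (∑ j ∈ s, z j * sgn (x j) - z i)) / 2 := by
  rw [rademacher, expect_indepLaw_resample _ i]
  congr 1
  funext x
  rw [expect_uniform_bool]
  have h (b : Bool) : ∑ j ∈ insert i s, z j * sgn (Function.update x i b j)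
      = ∑ j ∈ s, z j * sgn (x j) + z i * sgn b := by
    rw [Finset.sum_insert hi, Function.update_self, add_comm]
    congr 1
    refine Finset.sum_congr rfl fun j hj => ?_
    rw [Function.update_of_ne (ne_of_mem_of_not_mem hj hi)]
  simp only [h]
  simp [sgn, sub_eq_add_neg]

theorem rademacher_sum_sq (z : ι → ℝ) (s : Finset ι) :
    (rademacher ι).expect (fun x => (∑ j ∈ s, z j * sgn (x j)) ^ 2) = ∑ j ∈ s, z j ^ 2 := by
  induction s using Finset.induction_on with
  | empty => simp [PMF.expect_const]
  | insert i s hi ih =>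
    rw [rademacher_sum_insert z hi fun t => t ^ 2, Finset.sum_insert hi, ← ih]
    have h (t : ℝ) : ((t + z i) ^ 2 + (t - z i) ^ 2) / 2 = z i ^ 2 + t ^ 2 := by ring
    simp only [h, PMF.expect_add, PMF.expect_const]

theorem rademacher_sum_pow_four (z : ι → ℝ) (s : Finset ι) :
    (rademacher ι).expect (fun x => (∑ j ∈ s, z j * sgn (x j)) ^ 4)
      ≤ 3 * (∑ j ∈ s, z j ^ 2) ^ 2 := by
  induction s using Finset.induction_on with
  | empty => simp [PMF.expect_const]
  | insert i s hi ih =>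
    rw [rademacher_sum_insert z hi fun t => t ^ 4, Finset.sum_insert hi]
    have h (t : ℝ) : ((t + z i) ^ 4 + (t - z i) ^ 4) / 2
        = z i ^ 4 + (6 * z i ^ 2 * t ^ 2 + t ^ 4) := by ring
    simp only [h, PMF.expect_add, PMF.expect_const, PMF.expect_const_mul, rademacher_sum_sq]
    nlinarith [sq_nonneg (z i ^ 2)]

/-- A sum of independent signs is not small with constant probability. -/
theorem rademacher_large (z : ι → ℝ) : 1 / 6 ≤ (rademacher ι).expect fun x =>
    if (∑ j, z j ^ 2) / 4 ≤ (∑ j, z j * sgn (x j)) ^ 2 then 1 else 0 := by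
  set V := ∑ j, z j ^ 2 with hV
  have hV0 : 0 ≤ V := Finset.sum_nonneg fun j _ => sq_nonneg _
  rcases hV0.eq_or_lt with h0 | hpos
  · have h (x : ι → Bool) : V / 4 ≤ (∑ j, z j * sgn (x j)) ^ 2 := by
      rw [← h0, zero_div]
      positivity
    simp only [h, if_true, PMF.expect_const]
    norm_num
  -- Paley–Zygmund with a polynomial: `6Vt² - t⁴` never exceeds `9V²`, and is at most `3V²/2` when
  -- `t² < V/4`. By the second and fourth moments the left side has mean at least `3V²/2`.
  · have hpt (x : ι → Bool) : 6 * V * (∑ j, z j * sgn (x j)) ^ 2 - (∑ j, z j * sgn (x j)) ^ 4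
        - 3 / 2 * V ^ 2
        ≤ 9 * V ^ 2 * if V / 4 ≤ (∑ j, z j * sgn (x j)) ^ 2 then 1 else 0 := by
      generalize ∑ j, z j * sgn (x j) = t
      split_ifs with h
      · nlinarith [sq_nonneg (t ^ 2 - 3 * V)]
      · nlinarith [sq_nonneg (t ^ 2), not_le.1 h]
    have h1 := (rademacher ι).expect_mono hpt
    rw [PMF.expect_sub, PMF.expect_sub, PMF.expect_const, PMF.expect_const_mul,
      PMF.expect_const_mul, rademacher_sum_sq, ← hV] at h1
    have h2 := rademacher_sum_pow_four z Finset.univ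
    rw [← hV] at h2
    have h3 : 0 < V ^ 2 := by positivity
    nlinarith

theorem rademacher_exp_le (a : ι → ℝ) (ha : ∀ i, a i ^ 2 = 1) (t : ℝ) :
    (rademacher ι).expect (fun x => Real.exp (t * ∑ i, a i * sgn (x i)))
      ≤ Real.exp (t ^ 2 / 2) ^ Fintype.card ι := by
  have h1 (x : ι → Bool) : Real.exp (t * ∑ i, a i * sgn (x i))
      = ∏ i, Real.exp (t * (a i * sgn (x i))) := by
    rw [Finset.mul_sum, Real.exp_sum]
  simp only [h1]
  rw [rademacher, expect_indepLaw_prod _ fun i b => Real.exp (t * (a i * sgn b)),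
    ← Finset.card_univ, ← Finset.prod_const]
  refine Finset.prod_le_prod (fun i _ => ?_) fun i _ => ?_
  · rw [expect_uniform_bool]
    positivity
  · rw [expect_uniform_bool]
    refine le_trans (le_of_eq ?_) (Real.cosh_le_exp_half_sq t)
    have h2 : a i = 1 ∨ a i = -1 := mul_self_eq_one_iff.1 (by rw [← sq]; exact ha i)
    rw [Real.cosh_eq]
    rcases h2 with h2 | h2 <;> simp [h2, sgn, add_comm]

end Rademacher

/-! ### Sign matrices that keep every vector visible in many rows. -/

/-- The norm from `ℓ^∞` to `ℓ^1` is attained at sign vectors: `σ` absorbs the absolute values, and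
the form is then linear in `e`, hence largest at a vertex of the cube. Only finitely many pairs
remain for a union bound. -/
theorem sum_abs_le_of_sum_sgn_le {R : Type*} [Fintype R] {k : ℕ} (s : R → Fin k → Bool) {B : ℝ}
    (hs : ∀ (σ : R → Bool) (w : Fin k → Bool),
      ∑ r, sgn (σ r) * ∑ i, sgn (w i) * sgn (s r i) ≤ B)
    (e : Fin k → ℝ) (he : ∀ i, |e i| ≤ 1) : ∑ r, |∑ i, e i * sgn (s r i)| ≤ B := by
  set σ : R → Bool := fun r => decide (0 ≤ ∑ i, e i * sgn (s r i)) with hσ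
  set w : Fin k → Bool := fun i => decide (0 ≤ ∑ r, sgn (σ r) * sgn (s r i)) with hw
  calc ∑ r, |∑ i, e i * sgn (s r i)| = ∑ r, sgn (σ r) * ∑ i, e i * sgn (s r i) :=
        Finset.sum_congr rfl fun r _ => (sgn_decide_mul _).symm
    _ = ∑ i, e i * ∑ r, sgn (σ r) * sgn (s r i) := by
        simp only [Finset.mul_sum]
        rw [Finset.sum_comm]
        exact Finset.sum_congr rfl fun i _ => Finset.sum_congr rfl fun r _ => by ring
    _ ≤ ∑ i, sgn (w i) * ∑ r, sgn (σ r) * sgn (s r i) := by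
        refine Finset.sum_le_sum fun i _ => ?_
        rw [hw, sgn_decide_mul]
        refine (le_abs_self _).trans ?_
        rw [abs_mul]
        exact mul_le_of_le_one_left (abs_nonneg _) (he i)
    _ = ∑ r, sgn (σ r) * ∑ i, sgn (w i) * sgn (s r i) := by
        simp only [Finset.mul_sum]
        rw [Finset.sum_comm]
        exact Finset.sum_congr rfl fun i _ => Finset.sum_congr rfl fun r _ => by ring
    _ ≤ B := hs σ w

section signMatrix

variable {R : Type*} [Fintype R] [DecidableEq R] {k : ℕ}

/-- The law of a matrix of independent uniform signs. -/
noncomputable def rademacherMatrix (R : Type*) [Fintype R] [DecidableEq R] (k : ℕ) :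
    PMF (R → Fin k → Bool) :=
  indepLaw fun _ => rademacher (Fin k)

/-- The number of rows of a sign matrix that are not almost orthogonal to `z`. -/
noncomputable def numLargeRows (z : Fin k → ℝ) (s : R → Fin k → Bool) : ℕ :=
  (Finset.univ.filter fun r => (∑ j, z j ^ 2) / 4 ≤ (∑ j, z j * sgn (s r j)) ^ 2).card

/-- Chernoff's method applied to `2^(-numLargeRows)`: by `rademacher_large` each row contributes a
factor of mean at most `11/12`. The ratio `32` is what makes `2 (11/12)^32 ≤ 1/8`. -/
theorem rademacherMatrix_numLargeRows (z : Fin k → ℝ) {N : ℕ} (hR : Fintype.card R = 32 * N) :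
    (rademacherMatrix R k).expect (fun s => if numLargeRows z s < N then 1 else 0)
      ≤ (1 / 8) ^ N := by
  have hpt (s : R → Fin k → Bool) : (if numLargeRows z s < N then 1 else 0 : ℝ)
      ≤ 2 ^ N * ∏ r, (1 - 1 / 2 *
        if (∑ j, z j ^ 2) / 4 ≤ (∑ j, z j * sgn (s r j)) ^ 2 then 1 else 0) := by
    have h1 (r : R) : (1 - 1 / 2 *
        if (∑ j, z j ^ 2) / 4 ≤ (∑ j, z j * sgn (s r j)) ^ 2 then 1 else 0 : ℝ)
        = if (∑ j, z j ^ 2) / 4 ≤ (∑ j, z j * sgn (s r j)) ^ 2 then 1 / 2 else 1 := by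
      split_ifs <;> norm_num
    simp only [h1]
    rw [← Finset.prod_filter, Finset.prod_const]
    change _ ≤ (2 : ℝ) ^ N * (1 / 2) ^ numLargeRows z s
    split_ifs with h
    · calc (1 : ℝ) = 2 ^ N * (1 / 2) ^ N := by rw [← mul_pow]; norm_num
        _ ≤ _ := by
          refine mul_le_mul_of_nonneg_left ?_ (by positivity)
          exact pow_le_pow_of_le_one (by norm_num) (by norm_num) h.le
    · positivity
  refine (PMF.expect_mono _ hpt).trans ?_
  rw [PMF.expect_const_mul, rademacherMatrix, expect_indepLaw_prod _ fun _ (x : Fin k → Bool) => (1 - 1 / 2 *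
        if (∑ j, z j ^ 2) / 4 ≤ (∑ j, z j * sgn (x j)) ^ 2 then 1 else 0 : ℝ),
    Finset.prod_const, Finset.card_univ, hR, PMF.expect_sub, PMF.expect_const,
    PMF.expect_const_mul]
  have h2 := rademacher_large z
  set e := (rademacher (Fin k)).expect fun x =>
    if (∑ j, z j ^ 2) / 4 ≤ (∑ j, z j * sgn (x j)) ^ 2 then 1 else 0 with he
  have h3 : e ≤ 1 := by
    rw [← PMF.expect_const (rademacher (Fin k)) 1]
    refine PMF.expect_mono _ fun x => ?_
    split_ifs <;> norm_num
  calc (2 : ℝ) ^ N * (1 - 1 / 2 * e) ^ (32 * N) ≤ 2 ^ N * (11 / 12) ^ (32 * N) := by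
        gcongr
        · linarith
        · linarith
    _ = (2 * (11 / 12) ^ 32) ^ N := by rw [pow_mul, mul_pow]
    _ ≤ (1 / 8) ^ N := by
        gcongr
        norm_num

/-- For fixed `σ` and `w` the exponent is a sum of `k * card R` independent uniform signs, scaled by
`t`. -/
theorem rademacherMatrix_exp_le (σ : R → Bool) (w : Fin k → Bool) (t : ℝ) :
    (rademacherMatrix R k).expect
        (fun s => Real.exp (t * ∑ r, sgn (σ r) * ∑ i, sgn (w i) * sgn (s r i)))
      ≤ Real.exp (t ^ 2 / 2) ^ (k * Fintype.card R) := by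
  have h1 (s : R → Fin k → Bool) :
      Real.exp (t * ∑ r, sgn (σ r) * ∑ i, sgn (w i) * sgn (s r i))
        = ∏ r, Real.exp (t * ∑ i, (sgn (σ r) * sgn (w i)) * sgn (s r i)) := by
    rw [Finset.mul_sum, Real.exp_sum]
    simp only [Finset.mul_sum, mul_assoc]
  simp only [h1]
  rw [rademacherMatrix, expect_indepLaw_prod _ fun r (x : Fin k → Bool) =>
    Real.exp (t * ∑ i, (sgn (σ r) * sgn (w i)) * sgn (x i)), pow_mul, ← Finset.card_univ,
    ← Finset.prod_const]
  refine Finset.prod_le_prod (fun r _ => ?_) fun r _ => ?_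
  · rw [← PMF.expect_const (rademacher (Fin k)) 0]
    exact PMF.expect_mono _ fun x => (Real.exp_pos _).le
  · have h2 := rademacher_exp_le (fun i => sgn (σ r) * sgn (w i))
      (fun i => by rw [mul_pow, sgn_sq, sgn_sq, mul_one]) t
    rwa [Fintype.card_fin] at h2

theorem sum_geometric_bool_fin_le (L : ℕ) :
    ∑ q : Bool × Fin (L + 1), (1 / 2 : ℝ) ^ (q.2 : ℕ) ≤ 4 := by
  rw [Fintype.sum_prod_type]
  simp only [Fintype.sum_bool]
  rw [Fin.sum_univ_eq_sum_range fun n => (1 / 2 : ℝ) ^ n]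
  have := sum_geometric_two_le (L + 1)
  linarith

/-- There is a sign matrix with `32 * N` rows which has small norm from `ℓ^∞` to `ℓ^1` and `N` rows
of which are not almost orthogonal to any given lattice vector of small `ℓ^1` norm. -/
theorem exists_signMatrix_lattice {N L : ℕ} (hk : 1 ≤ k) (hL : L = 601 * k) (hN : 256 * k ≤ N)
    (hR : Fintype.card R = 32 * N) :
    ∃ s : R → Fin k → Bool,
      (∀ q : Fin k → Bool × Fin (L + 1), ∑ i, (q i).2.val ≤ L →
        N ≤ numLargeRows (fun i => sgn (q i).1 * (q i).2.val) s) ∧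
      ∀ (σ : R → Bool) (w : Fin k → Bool),
        ∑ r, sgn (σ r) * ∑ i, sgn (w i) * sgn (s r i) ≤ 2 * Fintype.card R * √k := by
  set T := Fintype.card R with hT
  have hk0 : (0 : ℝ) < k := by exact_mod_cast hk
  have hsk : 0 < √(k : ℝ) := Real.sqrt_pos.2 hk0
  -- These weights replace counting lattice points: they are at least `1` on the `ℓ^1` ball of
  -- radius `L`, while their total is at most `2^L 4^k`.
  set wt : (Fin k → Bool × Fin (L + 1)) → ℝ :=
    fun q => 2 ^ L * ∏ i, (1 / 2 : ℝ) ^ ((q i).2 : ℕ) with hwt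
  have hwt0 (q) : 0 ≤ wt q := by positivity
  set bad : (Fin k → Bool × Fin (L + 1)) → (R → Fin k → Bool) → ℝ := fun q s =>
    if numLargeRows (fun i => sgn (q i).1 * (q i).2.val) s < N then 1 else 0 with hbad
  have hbad0 (q s) : 0 ≤ bad q s := by simp only [hbad]; split_ifs <;> norm_num
  set S : (R → Bool) × (Fin k → Bool) → (R → Fin k → Bool) → ℝ := fun u s =>
    ∑ r, sgn (u.1 r) * ∑ i, sgn (u.2 i) * sgn (s r i) with hS
  -- The optimal Chernoff parameter for the level `2T√k`: each sign pair fails with probability at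
  -- most `exp(2T - 4T)`, which beats the `2^(T+k) ≤ 4^T` pairs because `e² > 7`.
  set t : ℝ := 2 / √k with ht
  have ht0 : 0 < t := by positivity
  have h1 : (rademacherMatrix R k).expect (fun s => ∑ q, wt q * bad q s) ≤ 1 / 2 := by
    rw [PMF.expect_sum]
    simp only [PMF.expect_const_mul]
    have h2 : ∑ q, wt q ≤ 2 ^ L * 4 ^ k := by
      simp only [hwt, ← Finset.mul_sum]
      refine mul_le_mul_of_nonneg_left ?_ (by positivity)
      rw [← Fintype.prod_sum (fun (_ : Fin k) (p : Bool × Fin (L + 1)) => (1 / 2 : ℝ) ^ (p.2 : ℕ))]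
      simp only [Finset.prod_const, Finset.card_univ, Fintype.card_fin]
      exact pow_le_pow_left₀ (Finset.sum_nonneg fun q _ => by positivity)
        (sum_geometric_bool_fin_le L) k
    calc ∑ q, wt q * (rademacherMatrix R k).expect (bad q) ≤ ∑ q, wt q * (1 / 8) ^ N :=
          Finset.sum_le_sum fun q _ =>
            mul_le_mul_of_nonneg_left (rademacherMatrix_numLargeRows _ hR) (hwt0 q)
      _ ≤ 2 ^ L * 4 ^ k * (1 / 8) ^ (256 * k) := by
          rw [← Finset.sum_mul]
          exact mul_le_mul h2 (pow_le_pow_of_le_one (by norm_num) (by norm_num) hN)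
            (by positivity) (by positivity)
      _ = (1 / 2) ^ (165 * k) := by
          rw [hL, show (4 : ℝ) = 2 ^ 2 by norm_num, show (1 / 8 : ℝ) = (1 / 2) ^ 3 by norm_num,
            ← pow_mul, ← pow_mul, ← pow_add, show 601 * k + 2 * k = 603 * k by ring,
            show 3 * (256 * k) = 603 * k + 165 * k by ring, pow_add, ← mul_assoc, ← mul_pow]
          norm_num
      _ ≤ (1 / 2) ^ 1 := pow_le_pow_of_le_one (by norm_num) (by norm_num) (by omega)
      _ = 1 / 2 := by norm_num
  have h2 : (rademacherMatrix R k).expect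
      (fun s => ∑ u, Real.exp (-(4 * T)) * Real.exp (t * S u s)) ≤ 1 / 3 := by
    rw [PMF.expect_sum]
    simp only [PMF.expect_const_mul]
    have h3 : Real.exp (t ^ 2 / 2) ^ (k * T) = Real.exp (2 * T) := by
      rw [← Real.exp_nat_mul]
      congr 1
      rw [ht, div_pow, Real.sq_sqrt hk0.le]
      push_cast
      field_simp
    have hkT : k ≤ T := by omega
    have hT2 : 2 ≤ T := by omega
    calc ∑ u, Real.exp (-(4 * T)) * (rademacherMatrix R k).expect (fun s => Real.exp (t * S u s))
        ≤ ∑ _u : (R → Bool) × (Fin k → Bool), Real.exp (-(4 * T)) * Real.exp (2 * T) := by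
          refine Finset.sum_le_sum fun u _ => mul_le_mul_of_nonneg_left ?_ (Real.exp_pos _).le
          exact (rademacherMatrix_exp_le u.1 u.2 t).trans (le_of_eq h3)
      _ = 2 ^ (T + k) * Real.exp (-2) ^ T := by
          rw [Finset.sum_const, ← Real.exp_add, Finset.card_univ, Fintype.card_prod,
            Fintype.card_fun, Fintype.card_fun, Fintype.card_bool, Fintype.card_fin, ← hT,
            nsmul_eq_mul, ← Real.exp_nat_mul, ← pow_add]
          push_cast
          congr 2
          ring
      _ ≤ 2 ^ (T + T) * (1 / 7) ^ T := by
          gcongr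
          · norm_num
          · rw [Real.exp_neg, one_div]
            apply inv_anti₀ (by norm_num)
            have := Real.exp_one_gt_d9
            rw [show (2 : ℝ) = 1 + 1 by norm_num, Real.exp_add]
            nlinarith
      _ = (4 / 7) ^ T := by
          rw [← two_mul, pow_mul, ← mul_pow]
          norm_num
      _ ≤ (4 / 7) ^ 2 := pow_le_pow_of_le_one (by norm_num) (by norm_num) hT2
      _ ≤ 1 / 3 := by norm_num
  obtain ⟨s, hs⟩ := (rademacherMatrix R k).exists_lt_of_expect_lt
    (f := fun s => ∑ q, wt q * bad q s + ∑ u, Real.exp (-(4 * T)) * Real.exp (t * S u s))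
    (c := 1) (by rw [PMF.expect_add]; linarith)
  have hA0 : 0 ≤ ∑ q, wt q * bad q s :=
    Finset.sum_nonneg fun q _ => mul_nonneg (hwt0 q) (hbad0 q s)
  have hB0 : 0 ≤ ∑ u, Real.exp (-(4 * T)) * Real.exp (t * S u s) :=
    Finset.sum_nonneg fun u _ => by positivity
  refine ⟨s, fun q hq => ?_, fun σ w => ?_⟩
  · by_contra hlt
    have h3 : wt q * bad q s ≤ ∑ q, wt q * bad q s :=
      Finset.single_le_sum (fun q _ => mul_nonneg (hwt0 q) (hbad0 q s)) (Finset.mem_univ q)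
    have h4 : bad q s = 1 := if_pos (not_le.1 hlt)
    have h5 : 1 ≤ wt q := by
      simp only [hwt]
      rw [Finset.prod_pow_eq_pow_sum]
      calc (1 : ℝ) = 2 ^ L * (1 / 2) ^ L := by rw [← mul_pow]; norm_num
        _ ≤ _ := mul_le_mul_of_nonneg_left
          (pow_le_pow_of_le_one (by norm_num) (by norm_num) hq) (by positivity)
    rw [h4, mul_one] at h3
    linarith
  · by_contra hlt
    have h3 : Real.exp (-(4 * T)) * Real.exp (t * S (σ, w) s)
        ≤ ∑ u, Real.exp (-(4 * T)) * Real.exp (t * S u s) :=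
      Finset.single_le_sum (f := fun u => Real.exp (-(4 * (T : ℝ))) * Real.exp (t * S u s))
        (fun u _ => by positivity) (Finset.mem_univ (σ, w))
    have h4 : t * (2 * T * √k) = 4 * T := by
      rw [ht]
      field_simp
      ring
    have h5 : t * (2 * T * √k) ≤ t * S (σ, w) s :=
      mul_le_mul_of_nonneg_left (not_le.1 hlt).le ht0.le
    have h6 : 1 ≤ Real.exp (-(4 * T)) * Real.exp (t * S (σ, w) s) := by
      rw [← Real.exp_add, Real.one_le_exp_iff]
      linarith
    linarith

/-- There is a sign matrix with `O(k)` rows such that no vector is almost orthogonal to most of its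
rows. -/
theorem exists_signMatrix {N : ℕ} (hk : 1 ≤ k) (hN : 256 * k ≤ N)
    (hR : Fintype.card R = 32 * N) :
    ∃ s : R → Fin k → Bool, ∀ v : Fin k → ℝ,
      (N : ℝ) / 2 ≤ (Finset.univ.filter fun r =>
        (∑ i, v i ^ 2) / 64 ≤ (∑ i, v i * sgn (s r i)) ^ 2).card := by
  obtain ⟨s, hs1, hs2⟩ := exists_signMatrix_lattice (R := R) hk rfl hN hR
  refine ⟨s, fun v => ?_⟩
  set V := ∑ i, v i ^ 2 with hV
  have hV0 : 0 ≤ V := Finset.sum_nonneg fun i _ => sq_nonneg _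
  have hk0 : (0 : ℝ) < k := by exact_mod_cast hk
  have hsk : 0 < √(k : ℝ) := Real.sqrt_pos.2 hk0
  have hsk2 : √(k : ℝ) ^ 2 = k := Real.sq_sqrt hk0.le
  rcases hV0.eq_or_lt with h0 | hpos
  · rw [Finset.filter_true_of_mem, Finset.card_univ, hR]
    · push_cast
      have : (0 : ℝ) ≤ N := by positivity
      linarith
    · intro r _
      rw [← h0, zero_div]
      positivity
  -- The mesh of the lattice to which `v` is rounded. By Cauchy–Schwarz `v/l` has `ℓ^1` norm at most
  -- `601k`, while `‖v/l‖² = 601² k` dwarfs the squared rounding error, which is at most `k`.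
  set l : ℝ := √V / (601 * √k) with hl
  have hl0 : 0 < l := div_pos (Real.sqrt_pos.2 hpos) (by positivity)
  have hl2 : V = l ^ 2 * (601 ^ 2 * k) := by
    rw [hl, div_pow, mul_pow, hsk2, Real.sq_sqrt hV0]
    field_simp
  have habs : ∑ i, |v i| / l ≤ 601 * k := by
    rw [← Finset.sum_div, div_le_iff₀ hl0]
    have h1 : (∑ i, |v i|) ^ 2 ≤ k * V := by
      have := sq_sum_le_card_mul_sum_sq (s := Finset.univ) (f := fun i => |v i|)
      simpa [sq_abs] using this
    refine abs_le_of_sq_le_sq' (h1.trans (le_of_eq ?_)) (by positivity) |>.2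
    rw [hl2]
    ring
  set n : Fin k → ℕ := fun i => ⌊|v i| / l⌋₊ with hn
  have hn1 (i : Fin k) : (n i : ℝ) ≤ |v i| / l := Nat.floor_le (by positivity)
  have hnsum : ∑ i, n i ≤ 601 * k := by
    have : ((∑ i, n i : ℕ) : ℝ) ≤ (601 * k : ℕ) := by
      push_cast
      exact (Finset.sum_le_sum fun i _ => hn1 i).trans habs
    exact_mod_cast this
  have hnL (i : Fin k) : n i < 601 * k + 1 :=
    Nat.lt_succ_of_le ((Finset.single_le_sum (fun _ _ => Nat.zero_le _)
      (Finset.mem_univ i)).trans hnsum)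
  set q : Fin k → Bool × Fin (601 * k + 1) := fun i => (decide (0 ≤ v i), ⟨n i, hnL i⟩) with hq
  have hlarge := hs1 q hnsum
  set z : Fin k → ℝ := fun i => sgn (decide (0 ≤ v i)) * n i with hz
  change N ≤ numLargeRows z s at hlarge
  set e : Fin k → ℝ := fun i => v i / l - z i with he
  have he1 (i : Fin k) : |e i| ≤ 1 := by
    have h1 : v i = sgn (decide (0 ≤ v i)) * |v i| := by
      rw [← sgn_decide_mul, ← mul_assoc, ← sq, sgn_sq, one_mul]
    have h2 : e i = sgn (decide (0 ≤ v i)) * (|v i| / l - n i) := by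
      simp only [he, hz]
      rw [mul_sub, ← mul_div_assoc, ← h1]
    have h3 : |sgn (decide (0 ≤ v i))| = 1 := by
      rcases sgn_eq (decide (0 ≤ v i)) with h | h <;> simp [h]
    rw [h2, abs_mul, h3, one_mul, abs_le]
    have := Nat.lt_floor_add_one (|v i| / l)
    constructor
    · linarith [hn1 i]
    · have h4 : (n i : ℝ) = ⌊|v i| / l⌋₊ := rfl
      linarith
  have hve (i : Fin k) : v i = l * (z i + e i) := by
    simp only [he]
    field_simp
    ring
  have hznorm : 180000 * k ≤ ∑ i, z i ^ 2 := by
    have h1 : V ≤ ∑ i, (2 * l ^ 2 * z i ^ 2 + 2 * l ^ 2) := by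
      refine Finset.sum_le_sum fun i _ => ?_
      have h2 : e i ^ 2 ≤ 1 := (sq_le_one_iff_abs_le_one _).2 (he1 i)
      rw [hve i, mul_pow]
      have h3 : (z i + e i) ^ 2 ≤ 2 * z i ^ 2 + 2 := by nlinarith [sq_nonneg (z i - e i)]
      nlinarith [sq_nonneg l]
    rw [Finset.sum_add_distrib, ← Finset.mul_sum, Finset.sum_const, Finset.card_univ,
      Fintype.card_fin, nsmul_eq_mul, hl2] at h1
    have h2 : 0 < l ^ 2 := by positivity
    have h3 : l ^ 2 * (601 ^ 2 * k) ≤ l ^ 2 * (2 * ∑ i, z i ^ 2 + 2 * k) := by linarith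
    have h4 := le_of_mul_le_mul_left h3 h2
    linarith
  -- few rows see the rounding error
  set F := Finset.univ.filter fun r => 128 * √k < |∑ i, e i * sgn (s r i)| with hF
  have hFcard : (F.card : ℝ) ≤ N / 2 := by
    have h1 := sum_abs_le_of_sum_sgn_le s hs2 e he1
    have h2 : F.card * (128 * √k) ≤ ∑ r, |∑ i, e i * sgn (s r i)| := by
      rw [← nsmul_eq_mul, ← Finset.sum_const]
      refine (Finset.sum_le_sum fun r hr => (Finset.mem_filter.1 hr).2.le).trans ?_
      exact Finset.sum_le_sum_of_subset_of_nonneg (Finset.subset_univ _)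
        fun r _ _ => abs_nonneg _
    rw [hR] at h1
    push_cast at h1
    have h3 : F.card * (128 * √k) ≤ N / 2 * (128 * √k) := by
      refine (h2.trans h1).trans (le_of_eq ?_)
      ring
    exact le_of_mul_le_mul_right h3 (by positivity)
  have hsub : (Finset.univ.filter fun r => (∑ j, z j ^ 2) / 4 ≤ (∑ j, z j * sgn (s r j)) ^ 2)
      ⊆ (Finset.univ.filter fun r => V / 64 ≤ (∑ i, v i * sgn (s r i)) ^ 2) ∪ F := by
    intro r hr
    rw [Finset.mem_union]
    by_cases hrF : r ∈ F
    · exact Or.inr hrF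
    refine Or.inl (Finset.mem_filter.2 ⟨Finset.mem_univ r, ?_⟩)
    have h1 := (Finset.mem_filter.1 hr).2
    have h2 : |∑ i, e i * sgn (s r i)| ≤ 128 * √k := by
      by_contra h
      exact hrF (Finset.mem_filter.2 ⟨Finset.mem_univ r, not_le.1 h⟩)
    have h3 : ∑ i, v i * sgn (s r i)
        = l * (∑ i, z i * sgn (s r i) + ∑ i, e i * sgn (s r i)) := by
      rw [← Finset.sum_add_distrib, Finset.mul_sum]
      refine Finset.sum_congr rfl fun i _ => ?_
      nth_rw 1 [hve i]
      ring
    -- Here `212² ≤ 180000/4`. Subtracting the rounding error `128√k` leaves `84√k`, and `84² ≥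
    -- 601²/64`.
    have h4 : 212 * √k ≤ |∑ i, z i * sgn (s r i)| := by
      refine abs_le_of_sq_le_sq' ?_ (abs_nonneg _) |>.2
      rw [sq_abs, mul_pow, hsk2]
      linarith
    have h5 : 84 * √k ≤ |∑ i, z i * sgn (s r i) + ∑ i, e i * sgn (s r i)| := by
      have h6 := abs_sub_abs_le_abs_sub (∑ i, z i * sgn (s r i)) (-∑ i, e i * sgn (s r i))
      rw [abs_neg, sub_neg_eq_add] at h6
      linarith
    rw [h3, hl2, mul_pow, ← sq_abs (∑ i, z i * sgn (s r i) + ∑ i, e i * sgn (s r i)),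
      mul_div_assoc]
    refine mul_le_mul_of_nonneg_left ?_ (sq_nonneg l)
    calc (601 : ℝ) ^ 2 * k / 64 ≤ (84 * √k) ^ 2 := by
          rw [mul_pow, hsk2]
          linarith
      _ ≤ _ := by gcongr
  have hcard := (Finset.card_le_card hsub).trans (Finset.card_union_le _ _)
  have hlarge2 : (N : ℝ) ≤ numLargeRows z s := by exact_mod_cast hlarge
  have hcard2 : (numLargeRows z s : ℝ) ≤ (Finset.univ.filter fun r =>
      V / 64 ≤ (∑ i, v i * sgn (s r i)) ^ 2).card + F.card := by exact_mod_cast hcard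
  linarith

end signMatrix

/-! ### The private random sign. -/

section signBit

variable {a : ℕ}

theorem sum_fin_succ_bool (F : Bool → (Fin a → Bool) → ℝ) :
    ∑ y : Fin (a + 1) → Bool, F (y 0) (Fin.tail y) = ∑ t, (F true t + F false t) := by
  rw [← (Fin.consEquiv fun _ : Fin (a + 1) => Bool).sum_comp, Fintype.sum_prod_type,
    Fintype.sum_bool, ← Finset.sum_add_distrib]
  simp [Fin.consEquiv]

/-- The law of a uniform string `t` of `a` bits, preceded by a random sign of mean `H t`. -/
noncomputable def signBitLaw (H : (Fin a → Bool) → ℝ) (hH : ∀ t, |H t| ≤ 1) :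
    PMF (Fin (a + 1) → Bool) :=
  PMF.ofFintype (fun y => ENNReal.ofReal ((1 + sgn (y 0) * H (Fin.tail y)) / (2 * 2 ^ a))) (by
    rw [← ENNReal.ofReal_sum_of_nonneg]
    · rw [sum_fin_succ_bool fun b t => (1 + sgn b * H t) / (2 * 2 ^ a)]
      have h (t : Fin a → Bool) : (1 + sgn true * H t) / (2 * 2 ^ a)
          + (1 + sgn false * H t) / (2 * 2 ^ a) = (1 : ℝ) / 2 ^ a := by
        simp only [sgn, if_true, Bool.false_eq_true, if_false]
        field_simp
        ring
      simp [h]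
    · intro y _
      refine div_nonneg ?_ (by positivity)
      have := abs_le.1 (hH (Fin.tail y))
      rcases sgn_eq (y 0) with h | h <;> rw [h] <;> linarith)

theorem one_add_sgn_mul_nonneg {t : ℝ} (ht : |t| ≤ 1) (b : Bool) : 0 ≤ 1 + sgn b * t := by
  have := abs_le.1 ht
  rcases sgn_eq b with h | h <;> rw [h] <;> linarith

theorem expect_signBitLaw (H : (Fin a → Bool) → ℝ) (hH : ∀ t, |H t| ≤ 1)
    (F : Bool → (Fin a → Bool) → ℝ) :
    (signBitLaw H hH).expect (fun y => F (y 0) (Fin.tail y))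
      = 1 / 2 ^ a * ∑ t, ((1 + H t) / 2 * F true t + (1 - H t) / 2 * F false t) := by
  have h (y : Fin (a + 1) → Bool) : (signBitLaw H hH y).toReal
      = (1 + sgn (y 0) * H (Fin.tail y)) / (2 * 2 ^ a) := by
    rw [signBitLaw, PMF.ofFintype_apply, ENNReal.toReal_ofReal]
    exact div_nonneg (one_add_sgn_mul_nonneg (hH _) _) (by positivity)
  simp only [PMF.expect, h]
  rw [sum_fin_succ_bool fun b t => (1 + sgn b * H t) / (2 * 2 ^ a) * F b t, Finset.mul_sum]
  refine Finset.sum_congr rfl fun t _ => ?_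
  simp only [sgn, if_true, Bool.false_eq_true, if_false]
  field_simp
  ring

/-- Signs of mean at most `ε / 4` in absolute value are `ε`-differentially private. -/
theorem signBitLaw_le {ε : ℝ} (hε0 : 0 < ε) (hε1 : ε ≤ 1) (H H' : (Fin a → Bool) → ℝ)
    (hH1 : ∀ t, |H t| ≤ 1) (hH1' : ∀ t, |H' t| ≤ 1)
    (hH : ∀ t, |H t| ≤ ε / 4) (hH' : ∀ t, |H' t| ≤ ε / 4) (y : Fin (a + 1) → Bool) :
    signBitLaw H hH1 y ≤ ENNReal.ofReal (Real.exp ε) * signBitLaw H' hH1' y := by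
  rw [signBitLaw, signBitLaw, PMF.ofFintype_apply, PMF.ofFintype_apply,
    ← ENNReal.ofReal_mul (Real.exp_pos ε).le, ← mul_div_assoc]
  refine ENNReal.ofReal_le_ofReal ?_
  gcongr
  have h1 : sgn (y 0) * H (Fin.tail y) ≤ ε / 4 := by
    have := abs_le.1 (hH (Fin.tail y))
    rcases sgn_eq (y 0) with h | h <;> rw [h] <;> linarith
  have h2 : -(ε / 4) ≤ sgn (y 0) * H' (Fin.tail y) := by
    have := abs_le.1 (hH' (Fin.tail y))
    rcases sgn_eq (y 0) with h | h <;> rw [h] <;> linarith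
  calc 1 + sgn (y 0) * H (Fin.tail y) ≤ (ε + 1) * (1 - ε / 4) := by nlinarith
    _ ≤ Real.exp ε * (1 + sgn (y 0) * H' (Fin.tail y)) :=
      mul_le_mul (Real.add_one_le_exp ε) (by linarith) (by linarith) (Real.exp_pos ε).le

end signBit

/-! ### The protocol and its statistics. -/

section tester

variable {R : Type*} [Fintype R] [DecidableEq R] {k m n a g : ℕ}

/-- A user with row `r` and samples `x` releases a private sign of mean proportional to `h r x`.
If these functions have mean zero under the uniform distribution and distinguish from it all
distributions that are far away, then the empirical means of the signs yield a uniformity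
tester. -/
theorem exists_tester_of_statistics [NeZero k] [Nonempty R] {α ε B : ℝ} (hε0 : 0 < ε)
    (hε1 : ε ≤ 1) (h : R → (Fin m → Fin k) → ℝ) (hh : ∀ r x, |h r x| ≤ 1)
    (hunif : ∀ r, (indepLaw fun _ : Fin m => unif k).expect (h r) = 0)
    (hfar : ∀ p : PMF (Fin k), α < tvDist p (unif k) →
      B ≤ ∑ r, (indepLaw fun _ : Fin m => p).expect (h r) ^ 2)
    (row : Fin n → (Fin a → Bool) → R) (I J : Finset (Fin n)) (hIJ : Disjoint I J)
    (hI : ∀ f : R → ℝ, ∑ i ∈ I, ∑ t, f (row i t) = 2 ^ a * g * ∑ r, f r)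
    (hJ : ∀ f : R → ℝ, ∑ i ∈ J, ∑ t, f (row i t) = 2 ^ a * g * ∑ r, f r)
    (hg : 1536 * √(Fintype.card R) ≤ g * ε ^ 2 * B) :
    ∃ P : Protocol k m n (a + 1), ((∀ i j, row i = row j) → P.IsSymmetric) ∧ P.IsUserLDP ε ∧
      P.IsUniformityTester α := by
  have hH (i : Fin n) (x : Fin m → Fin k) (t : Fin a → Bool) :
      |ε / 4 * h (row i t) x| ≤ ε / 4 := by
    rw [abs_mul, abs_of_pos (by positivity : 0 < ε / 4)]
    exact mul_le_of_le_one_right (by positivity) (hh _ _)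
  have hH1 (i : Fin n) (x : Fin m → Fin k) (t : Fin a → Bool) :
      |ε / 4 * h (row i t) x| ≤ 1 := (hH i x t).trans (by linarith)
  -- A message read as a vector with a single nonzero entry `±1`, at the row of the user. Hence the
  -- square of its product with `v` is one `v r ^ 2`, and a group has second moment constant `σ =
  -- g`.
  set φ : Fin n → (Fin (a + 1) → Bool) → R → ℝ :=
    fun i y r => sgn (y 0) * if row i (Fin.tail y) = r then 1 else 0 with hφ
  set W : (Fin n → Fin (a + 1) → Bool) → ℝ :=
    fun y => ∑ r, (∑ i ∈ I, φ i (y i) r) * (∑ j ∈ J, φ j (y j) r) with hW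
  -- Half of the lower bound on `‖μ‖²` for far distributions; `hg` makes it at least `48 g √|R|`.
  set τ : ℝ := (g * (ε / 4)) ^ 2 * B / 2 with hτ
  set P : Protocol k m n (a + 1) :=
    { randomizer := fun i x => signBitLaw (fun t => ε / 4 * h (row i t) x) (hH1 i x)
      decision := fun y => decide (W y < τ) } with hP
  have hT : (1 : ℝ) ≤ Fintype.card R := by exact_mod_cast Fintype.card_pos
  have hsT : 1 ≤ √(Fintype.card R : ℝ) := Real.one_le_sqrt.2 hT
  have hsT2 : √(Fintype.card R : ℝ) ^ 2 = Fintype.card R := Real.sq_sqrt (by linarith)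
  have hg0 : (0 : ℝ) < g := by
    rcases (Nat.cast_nonneg (α := ℝ) g).eq_or_lt with h0 | h0
    · rw [← h0] at hg
      linarith
    · exact h0
  have hτg : 48 * √(Fintype.card R) * g ≤ τ := by
    have h1 : τ = g * (g * ε ^ 2 * B) / 32 := by rw [hτ]; ring
    rw [h1]
    nlinarith
  have hτg' : 48 * g ≤ τ := by nlinarith
  have hτ0 : 0 < τ := by linarith
  have hτsq : 48 ^ 2 * Fintype.card R * (g : ℝ) ^ 2 ≤ τ ^ 2 := by
    calc 48 ^ 2 * Fintype.card R * (g : ℝ) ^ 2 = (48 * √(Fintype.card R) * g) ^ 2 := by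
          rw [mul_pow, mul_pow, hsT2]
      _ ≤ τ ^ 2 := by gcongr
  -- first and second moments of the messages
  have hmean (p : PMF (Fin k)) (K : Finset (Fin n))
      (hK : ∀ f : R → ℝ, ∑ i ∈ K, ∑ t, f (row i t) = 2 ^ a * g * ∑ r, f r) (r : R) :
      ∑ i ∈ K, (P.messageLaw p i).expect (fun y => φ i y r)
        = g * (ε / 4) * (indepLaw fun _ : Fin m => p).expect (h r) := by
    have h1 (i : Fin n) : (P.messageLaw p i).expect (fun y => φ i y r)
        = (indepLaw fun _ : Fin m => p).expect fun x =>
          1 / 2 ^ a * ∑ t, ε / 4 * h (row i t) x * if row i t = r then 1 else 0 := by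
      rw [Protocol.messageLaw, PMF.expect_bind]
      congr 1
      funext x
      simp only [hP, hφ]
      rw [expect_signBitLaw _ _ fun b t => sgn b * if row i t = r then 1 else 0]
      congr 1
      refine Finset.sum_congr rfl fun t _ => ?_
      simp only [sgn, if_true, Bool.false_eq_true, if_false]
      ring
    simp only [h1]
    rw [← PMF.expect_sum, ← PMF.expect_const_mul]
    congr 1
    funext x
    rw [← Finset.mul_sum, hK fun r' => ε / 4 * h r' x * if r' = r then 1 else 0]
    simp only [mul_ite, mul_one, mul_zero, Finset.sum_ite_eq', Finset.mem_univ, if_true]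
    field_simp
  have hsecond (p : PMF (Fin k)) (K : Finset (Fin n))
      (hK : ∀ f : R → ℝ, ∑ i ∈ K, ∑ t, f (row i t) = 2 ^ a * g * ∑ r, f r) (v : R → ℝ) :
      ∑ i ∈ K, (P.messageLaw p i).expect (fun y => (∑ r, v r * φ i y r) ^ 2)
        ≤ g * ∑ r, v r ^ 2 := by
    have h1 (i : Fin n) : (P.messageLaw p i).expect (fun y => (∑ r, v r * φ i y r) ^ 2)
        = 1 / 2 ^ a * ∑ t, v (row i t) ^ 2 := by
      have h2 (y : Fin (a + 1) → Bool) :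
          (∑ r, v r * φ i y r) ^ 2 = v (row i (Fin.tail y)) ^ 2 := by
        simp only [hφ, mul_ite, mul_one, mul_zero, Finset.sum_ite_eq, Finset.mem_univ, if_true]
        rw [mul_pow, sgn_sq, mul_one]
      rw [Protocol.messageLaw, PMF.expect_bind, ← PMF.expect_const (indepLaw fun _ : Fin m => p)
        (1 / 2 ^ a * ∑ t, v (row i t) ^ 2)]
      congr 1
      funext x
      simp only [h2, hP]
      rw [expect_signBitLaw _ _ fun _ t => v (row i t) ^ 2]
      congr 1
      exact Finset.sum_congr rfl fun t _ => by ring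
    simp only [h1]
    rw [← Finset.mul_sum, hK fun r => v r ^ 2]
    refine le_of_eq ?_
    field_simp
  have hvar (p : PMF (Fin k)) :=
    expect_sq_inner_sub_le (P.messageLaw p) I J hIJ φ g hg0.le
      (fun r => g * (ε / 4) * (indepLaw fun _ : Fin m => p).expect (h r))
      (hsecond p I hI) (hsecond p J hJ) (hmean p I hI) (hmean p J hJ)
  refine ⟨P, fun hrow i j => ?_, fun i x x' y => ?_, ?_, fun p hp => ?_⟩
  · simp only [hP, hrow i j]
  · exact signBitLaw_le hε0 hε1 _ _ (hH1 i x) (hH1 i x') (hH i x) (hH i x') y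
  · refine PMF.le_map_of_expect_sq_le _ P.decision true W 0 τ hτ0 (fun y hy => ?_) ?_
    · rw [sub_zero] at hy
      exact decide_eq_true ((le_abs_self _).trans_lt hy)
    · have h1 := hvar (unif k)
      simp only [hunif, mul_zero, ne_eq, OfNat.ofNat_ne_zero, not_false_eq_true, zero_pow,
        Finset.sum_const_zero, add_zero] at h1
      have h2 : 0 ≤ Fintype.card R * (g : ℝ) ^ 2 := by positivity
      change 3 * (indepLaw (P.messageLaw (unif k))).expect (fun y => (W y - 0) ^ 2) ≤ _
      refine (mul_le_mul_of_nonneg_left h1 (by norm_num)).trans ?_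
      linarith
  · have h1 := hvar p
    set M := ∑ r, (g * (ε / 4) * (indepLaw fun _ : Fin m => p).expect (h r)) ^ 2 with hM
    have hMτ : 2 * τ ≤ M := by
      have h2 : M = (g * (ε / 4)) ^ 2 * ∑ r, (indepLaw fun _ : Fin m => p).expect (h r) ^ 2 := by
        rw [hM, Finset.mul_sum]
        simp only [mul_pow]
      have h3 := mul_le_mul_of_nonneg_left (hfar p hp) (sq_nonneg (g * (ε / 4)))
      rw [h2, hτ]
      linarith
    refine PMF.le_map_of_expect_sq_le _ P.decision false W M (M / 2) (by linarith)
      (fun y hy => ?_) ?_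
    · refine decide_eq_false ?_
      have := (abs_lt.1 hy).1
      linarith
    · change 3 * (indepLaw (P.messageLaw p)).expect (fun y => (W y - M) ^ 2) ≤ _
      refine (mul_le_mul_of_nonneg_left h1 (by norm_num)).trans ?_
      have h2 : (g : ℝ) * M ≤ M / 96 * M := by
        apply mul_le_mul_of_nonneg_right <;> linarith
      have h3 : (2 * τ) ^ 2 ≤ M ^ 2 := by gcongr
      nlinarith

/-- The statistics of a sign matrix distinguish the uniform distribution from all others. -/
theorem exists_statistics [NeZero k] {N : ℕ} {α : ℝ} (hα : 0 < α) (hm : 1 ≤ m)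
    (hN : 256 * k ≤ N) (hR : Fintype.card R = 32 * N) (hmα : m * α ^ 2 ≤ √k) :
    ∃ h : R → (Fin m → Fin k) → ℝ, (∀ r x, |h r x| ≤ 1) ∧
      (∀ r, (indepLaw fun _ : Fin m => unif k).expect (h r) = 0) ∧
      ∀ p : PMF (Fin k), α < tvDist p (unif k) →
        N * (m * α ^ 2) / (8192 * k) ≤ ∑ r, (indepLaw fun _ : Fin m => p).expect (h r) ^ 2 := by
  have hk : 1 ≤ k := NeZero.one_le
  have hk1 : (1 : ℝ) ≤ k := by exact_mod_cast hk
  obtain ⟨s, hs⟩ := exists_signMatrix (R := R) hk hN hR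
  set G : R → (Fin m → Fin k) → ℝ := fun r x =>
    clip ((∑ i, sgn (s r (x i)) - m * (unif k).expect fun b => sgn (s r b)) / (6 * √m)) with hG
  have hG1 (r x) : |G r x| ≤ 1 := abs_clip_le _
  set c : R → ℝ := fun r => (indepLaw fun _ : Fin m => unif k).expect (G r) with hc
  have hc1 (r) : |c r| ≤ 1 := PMF.abs_expect_le _ (hG1 r)
  have hexp (p : PMF (Fin k)) (r : R) :
      (indepLaw fun _ : Fin m => p).expect (fun x => 1 / 2 * (G r x - c r))
        = 1 / 2 * ((indepLaw fun _ : Fin m => p).expect (G r) - c r) := by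
    rw [PMF.expect_const_mul, PMF.expect_sub, PMF.expect_const]
  -- Subtracting `c r` gives mean zero under `unif k`; the factor `1/2` restores the bound `1`.
  refine ⟨fun r x => 1 / 2 * (G r x - c r), fun r x => ?_, fun r => ?_, fun p hp => ?_⟩
  · rw [abs_mul, abs_of_pos (by norm_num : (0 : ℝ) < 1 / 2)]
    have := abs_sub (G r x) (c r)
    linarith [hG1 r x, hc1 r]
  · rw [hexp, hc, sub_self, mul_zero]
  set v : Fin k → ℝ := fun b => (p b).toReal - (unif k b).toReal with hv
  have hV : 4 * α ^ 2 / k ≤ ∑ b, v b ^ 2 := by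
    have h1 : 2 * α < ∑ b, |v b| := by
      rw [tvDist] at hp
      linarith
    have h2 := sq_sum_le_card_mul_sum_sq (s := Finset.univ) (f := fun b => |v b|)
    simp only [sq_abs, Finset.card_univ, Fintype.card_fin] at h2
    rw [div_le_iff₀ (by linarith)]
    nlinarith
  have hterm (r : R) (hr : (∑ b, v b ^ 2) / 64 ≤ (∑ b, v b * sgn (s r b)) ^ 2) :
      m * α ^ 2 / (4096 * k)
        ≤ (indepLaw fun _ : Fin m => p).expect (fun x => 1 / 2 * (G r x - c r)) ^ 2 := by
    have h1 := le_sq_expect_clip_sub p (unif k) (fun b => sgn (s r b)) (fun b => sgn_eq _) hm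
    have h2 : p.expect (fun b => sgn (s r b)) - (unif k).expect (fun b => sgn (s r b))
        = ∑ b, v b * sgn (s r b) := by
      simp only [PMF.expect, hv, sub_mul, Finset.sum_sub_distrib]
    rw [h2] at h1
    -- The cap `1` in the minimum is harmless because `mα² ≤ √k ≤ k`.
    have h3 : m * α ^ 2 / (16 * k) ≤ min 1 (m * (∑ b, v b * sgn (s r b)) ^ 2) := by
      refine le_min ?_ ?_
      · rw [div_le_one (by positivity)]
        have : √(k : ℝ) ≤ k := by
          rw [Real.sqrt_le_left (by linarith)]
          nlinarith
        linarith
      · calc m * α ^ 2 / (16 * k) = m * ((4 * α ^ 2 / k) / 64) := by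
              field_simp
              norm_num
          _ ≤ m * (∑ b, v b * sgn (s r b)) ^ 2 := by
              gcongr
              linarith
    rw [hexp, mul_pow]
    change _ ≤ ((indepLaw fun _ : Fin m => p).expect (G r) - c r) ^ 2 at h1
    have h4 : m * α ^ 2 / (4096 * k) = 1 / 256 * (m * α ^ 2 / (16 * k)) := by
      field_simp
      norm_num
    rw [h4]
    linarith
  calc N * (m * α ^ 2) / (8192 * k) = N / 2 * (m * α ^ 2 / (4096 * k)) := by
        field_simp
        ring
    _ ≤ (Finset.univ.filter fun r =>
        (∑ b, v b ^ 2) / 64 ≤ (∑ b, v b * sgn (s r b)) ^ 2).card * (m * α ^ 2 / (4096 * k)) :=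
        mul_le_mul_of_nonneg_right (hs v) (by positivity)
    _ ≤ ∑ r ∈ Finset.univ.filter fun r =>
        (∑ b, v b ^ 2) / 64 ≤ (∑ b, v b * sgn (s r b)) ^ 2,
        (indepLaw fun _ : Fin m => p).expect (fun x => 1 / 2 * (G r x - c r)) ^ 2 := by
        rw [← nsmul_eq_mul, ← Finset.sum_const]
        exact Finset.sum_le_sum fun r hr => hterm r (Finset.mem_filter.1 hr).2
    _ ≤ _ := Finset.sum_le_sum_of_subset_of_nonneg (Finset.subset_univ _)
        fun r _ _ => sq_nonneg _

end tester

/-! ### Choice of parameters and conclusion. -/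

/-- The number of users suffices for both protocols, with `2 ^ (c + 5)` rows. -/
theorem exists_testers {k m n : ℕ} [NeZero k] {α ε : ℝ} (hm : 1 ≤ m) (hα : 0 < α)
    (hε0 : 0 < ε) (hε1 : ε ≤ 1) (hmα : (m : ℝ) ≤ √k / α ^ 2)
    (hn : 500000000000 * ((k : ℝ) ^ (3 / 2 : ℝ) / (m * α ^ 2 * ε ^ 2)) ≤ n) :
    (∃ P : Protocol k m n 1, P.IsUserLDP ε ∧ P.IsUniformityTester α) ∧
      ∃ c : ℕ, 2 ^ c ≤ 512 * k ∧ ∃ P : Protocol k m n (c + 6),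
        P.IsSymmetric ∧ P.IsUserLDP ε ∧ P.IsUniformityTester α := by
  have hk : 1 ≤ k := NeZero.one_le
  have hk1 : (1 : ℝ) ≤ k := by exact_mod_cast hk
  have hm1 : (1 : ℝ) ≤ m := by exact_mod_cast hm
  have hsk : 1 ≤ √(k : ℝ) := Real.one_le_sqrt.2 hk1
  have hsk2 : √(k : ℝ) ^ 2 = k := Real.sq_sqrt (by linarith)
  have hmα' : m * α ^ 2 ≤ √k := (le_div_iff₀ (by positivity)).1 hmα
  have hk32 : (k : ℝ) ^ (3 / 2 : ℝ) = k * √k := by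
    rw [Real.sqrt_eq_rpow, ← Real.rpow_one_add' (by linarith) (by norm_num)]
    norm_num
  set D : ℝ := m * α ^ 2 * ε ^ 2 with hD
  have hD0 : 0 < D := by positivity
  rw [hk32, ← mul_div_assoc, div_le_iff₀ hD0] at hn
  have hDk : D ≤ √k := by
    calc D ≤ m * α ^ 2 * 1 := by
          rw [hD]
          gcongr
          exact pow_le_one₀ hε0.le hε1
      _ ≤ √k := by linarith
  -- A power of two, so that the `32N` rows are exactly the strings of `c + 5` bits.
  obtain ⟨c, hc1, hc2⟩ : ∃ c : ℕ, 256 * k ≤ 2 ^ c ∧ 2 ^ c ≤ 512 * k := by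
    obtain ⟨d, hd1, hd2⟩ := exists_nat_pow_near hk one_lt_two
    refine ⟨d + 9, ?_, ?_⟩ <;> · rw [pow_add]; rw [pow_succ] at hd2; omega
  set N := 2 ^ c with hN
  have hN1 : (256 : ℝ) * k ≤ N := by exact_mod_cast hc1
  have hN2 : (N : ℝ) ≤ 512 * k := by exact_mod_cast hc2
  have hR : Fintype.card (Fin (c + 5) → Bool) = 32 * N := by
    rw [Fintype.card_fun, Fintype.card_bool, Fintype.card_fin, pow_add, hN]
    ring
  obtain ⟨h, hh, hunif, hfar⟩ :=
    exists_statistics (R := Fin (c + 5) → Bool) (k := k) (m := m) hα hm hc1 hR hmα'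
  -- Two groups of `g` users for each of the `32N` rows. Below, the loss from this floor is absorbed
  -- by `D ≤ √k`, and `6291456 = 32 * 1536 * 128` is what `hgB` requires.
  set g := n / (64 * N) with hg
  have hgN : 64 * N * g ≤ n := Nat.mul_div_le n (64 * N)
  have hgk : 6291456 * √k ≤ g * D := by
    have h1 : (n : ℝ) < 64 * N * (g + 1) := by
      have : n < 64 * N * (g + 1) := Nat.lt_mul_div_succ n (by positivity)
      exact_mod_cast this
    have h2 : (n : ℝ) ≤ 32768 * k * (g + 1) := by
      exact h1.le.trans (mul_le_mul_of_nonneg_right (by linarith) (by positivity))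
    have h3 : 500000000000 * (k * √k) ≤ 32768 * k * (g + 1) * D :=
      hn.trans (by gcongr)
    have h4 : k * (500000000000 * √k) ≤ k * (32768 * (g + 1) * D) := by linarith
    have h5 := le_of_mul_le_mul_left h4 (by linarith)
    linarith
  have hgB : 1536 * √(Fintype.card (Fin (c + 5) → Bool) : ℝ)
      ≤ g * ε ^ 2 * (N * (m * α ^ 2) / (8192 * k)) := by
    have h1 : √(Fintype.card (Fin (c + 5) → Bool) : ℝ) ≤ 128 * √k := by
      rw [hR, Real.sqrt_le_left (by positivity), mul_pow, hsk2]
      push_cast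
      linarith
    have h2 : g * D / 32 ≤ g * ε ^ 2 * (N * (m * α ^ 2) / (8192 * k)) := by
      calc g * D / 32 = g * D * (256 * k) / (8192 * k) := by
            field_simp
            ring
        _ ≤ g * D * N / (8192 * k) := by gcongr
        _ = _ := by rw [hD]; ring
    linarith
  obtain ⟨e⟩ : Nonempty (Bool × ((Fin (c + 5) → Bool) × Fin g) ↪ Fin n) := by
    apply Function.Embedding.nonempty_of_card_le
    rw [Fintype.card_prod, Fintype.card_prod, hR, Fintype.card_bool, Fintype.card_fin,
      Fintype.card_fin]
    refine le_trans (le_of_eq ?_) hgN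
    ring
  set K : Bool → Finset (Fin n) := fun b =>
    Finset.univ.map ((Function.Embedding.sectR b _).trans e) with hK
  have hKdisj : Disjoint (K true) (K false) := by
    rw [Finset.disjoint_left]
    intro i h1 h2
    obtain ⟨q1, -, hq1⟩ := Finset.mem_map.1 h1
    obtain ⟨q2, -, hq2⟩ := Finset.mem_map.1 h2
    have := e.injective (hq1.trans hq2.symm)
    simp at this
  constructor
  -- Users outside the range of `e` get a dummy row; they belong to neither group, so the server
  -- ignores them.
  · set row : Fin n → (Fin 0 → Bool) → (Fin (c + 5) → Bool) := fun i _ =>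
      Function.extend e (fun q => q.2.1) (fun _ _ => true) i with hrow
    have hsum (b : Bool) (f : (Fin (c + 5) → Bool) → ℝ) :
        ∑ i ∈ K b, ∑ t, f (row i t) = 2 ^ 0 * g * ∑ r, f r := by
      simp only [hK, hrow, Finset.sum_map, Function.Embedding.trans_apply,
        Function.Embedding.sectR_apply, e.injective.extend_apply, Fintype.sum_prod_type]
      simp [Finset.mul_sum]
    obtain ⟨P, -, hP⟩ := exists_tester_of_statistics hε0 hε1 h hh hunif hfar row (K true)
      (K false) hKdisj (hsum true) (hsum false) hgB
    exact ⟨P, hP⟩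
  · refine ⟨c, hc2, ?_⟩
    -- Each user runs over all `2^(c+5)` rows, and a group has `2^(c+5) g` users, so on average
    -- every row is again used `g` times.
    have hsum (b : Bool) (f : (Fin (c + 5) → Bool) → ℝ) :
        ∑ _i ∈ K b, ∑ t, f t = 2 ^ (c + 5) * g * ∑ r, f r := by
      simp [hK, Fintype.card_prod]
    obtain ⟨P, hP1, hP2⟩ := exists_tester_of_statistics hε0 hε1 h hh hunif hfar
      (fun _ t => t) (K true) (K false) hKdisj (hsum true) (hsum false) hgB
    exact ⟨P, hP1 fun _ _ => rfl, hP2⟩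

theorem mainTheorem1 :
    (∃ C : ℝ, 0 < C ∧
      ∀ (k m n : ℕ) [NeZero k] (α ε : ℝ),
        2 ≤ k → 1 ≤ m → 0 < α → α ≤ 1 → 0 < ε → ε ≤ 1 →
        (m : ℝ) ≤ Real.sqrt k / α ^ 2 →
        C * ((k : ℝ) ^ (3 / 2 : ℝ) * Real.log (k / ε) / (m * α ^ 2 * ε ^ 2)) ≤ n →
        ∃ P : Protocol k m n 1, P.IsUserLDP ε ∧ P.IsUniformityTester α) ∧
    (∃ C : ℝ, 0 < C ∧
      ∀ (k m n : ℕ) [NeZero k] (α ε : ℝ),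
        2 ≤ k → 1 ≤ m → 0 < α → α ≤ 1 → 0 < ε → ε ≤ 1 →
        (m : ℝ) ≤ Real.sqrt k / α ^ 2 →
        C * ((k : ℝ) ^ (3 / 2 : ℝ) * max 1 (Real.log (k / (ε * α * m))) /
          (m * α ^ 2 * ε ^ 2)) ≤ n →
        ∃ b : ℕ, (b : ℝ) ≤ C * Real.log k ∧
          ∃ P : Protocol k m n b,
            P.IsSymmetric ∧ P.IsUserLDP ε ∧ P.IsUniformityTester α) := by
  have hlog {k : ℕ} (hk : 2 ≤ k) : 1 / 2 ≤ Real.log k := by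
    have h1 : Real.log 2 ≤ Real.log k :=
      Real.log_le_log (by norm_num) (by exact_mod_cast hk)
    linarith [Real.log_two_gt_d9]
  constructor
  · refine ⟨1000000000000, by norm_num, ?_⟩
    intro k m n _ α ε hk hm hα _ hε0 hε1 hmα hn
    refine (exists_testers hm hα hε0 hε1 hmα (le_trans ?_ hn)).1
    have hk0 : (0 : ℝ) < k := by positivity
    have h1 : 1 / 2 ≤ Real.log (k / ε) := by
      refine (hlog hk).trans (Real.log_le_log hk0 ?_)
      rw [le_div_iff₀ hε0]
      nlinarith
    calc 500000000000 * ((k : ℝ) ^ (3 / 2 : ℝ) / (m * α ^ 2 * ε ^ 2))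
        = 1000000000000 * ((k : ℝ) ^ (3 / 2 : ℝ) * (1 / 2) / (m * α ^ 2 * ε ^ 2)) := by ring
      _ ≤ _ := by gcongr
  · refine ⟨1000000000000, by norm_num, ?_⟩
    intro k m n _ α ε hk hm hα _ hε0 hε1 hmα hn
    obtain ⟨c, hc, P, hP⟩ := (exists_testers hm hα hε0 hε1 hmα (le_trans (by
      have h1 : (1 : ℝ) ≤ max 1 (Real.log (k / (ε * α * m))) := le_max_left _ _
      calc 500000000000 * ((k : ℝ) ^ (3 / 2 : ℝ) / (m * α ^ 2 * ε ^ 2))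
          ≤ 1000000000000 * ((k : ℝ) ^ (3 / 2 : ℝ) * 1 / (m * α ^ 2 * ε ^ 2)) := by
            rw [mul_one]
            gcongr
            norm_num
        _ ≤ _ := by gcongr) hn)).2
    refine ⟨c + 6, ?_, P, hP⟩
    have hk0 : (0 : ℝ) < k := by positivity
    have h1 : (2 : ℝ) ^ c ≤ 2 ^ 9 * k := by
      have : (2 : ℝ) ^ c ≤ 512 * k := by exact_mod_cast hc
      linarith
    have h2 := Real.log_le_log (by positivity) h1
    rw [Real.log_pow, Real.log_mul (by norm_num) hk0.ne', Real.log_pow] at h2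
    have h3 : Real.log 2 ≤ Real.log k :=
      Real.log_le_log (by norm_num) (by exact_mod_cast hk)
    have h4 := hlog hk
    have h5 := Real.log_two_gt_d9
    push_cast at h2 ⊢
    nlinarith [Nat.cast_nonneg (α := ℝ) c]
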